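/- **Setting.** A Málaga-$\mathcal M$ branch with pointing errors has parameters $\alpha>0$, $\beta\in\{1,2,\dots\}$, $\xi>0$, $\Omega\ge 0$, $d_0>0$, $\epsilon\in[0,1)$, $\Theta_A,\Theta_B\in\mathbb R$ and average SNR $\mu_1>0$; its SNR $\gamma$ has density $$f_\gamma(x)=\frac{\xi^2A}{2x}\sum_{m=1}^{\beta}b_m\,G^{3,0}_{1,3}\Big(\tfrac{Bx}{\mu_1}\Big|{-;\,\xi^2+1\atop \xi^2,\alpha,m;\,-}\Big),\qquad x>0,$$ with $h=2d_0(1-\epsilon)$, $\Omega'=\Omega+2d_0\epsilon+2\sqrt{2d_0\epsilon\Omega}\cos(\Theta_A-\Theta_B)$, $A=\frac{2\alpha^{\alpha/2}}{h^{1+\alpha/2}\Gamma(\alpha)}\big(\frac{\beta}{\beta+\Omega'/h}\big)^{\beta+\alpha/2}$, $B=\frac{\xi^2\alpha\beta(h+\Omega')}{(\xi^2+1)(h\beta+\Omega')}$, $b_m=\binom{\beta-1}{m-1}\frac{(h\beta+\Omega')^{1+\alpha/2}}{(m-1)!}\big(\frac{\Omega'}{h}\big)^{m-1}\beta^{-\alpha/2-m}\alpha^{-\alpha/2}$.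 Let $\mu_i$ be the $i$-th moment of $\gamma$ and $\varphi_i=\mu_i/\mu_{i-1}$. Put $\lambda=5\varphi_5-12\varphi_4+9\varphi_3-2\varphi_2$, $p=-4\varphi_4+9\varphi_3-6\varphi_2+\mu_1$, $s=-p$, $\sigma=25\varphi_5-48\varphi_4+27\varphi_3-4\varphi_2$, $r=\varphi_4-3\varphi_3+3\varphi_2-\mu_1$, $\delta=\varphi_5-3\varphi_4+3\varphi_3-\varphi_2$, $q=\mu_1-16\varphi_4+27\varphi_3-12\varphi_2$, $\phi=\lambda(p+s)+\sigma r+\delta q$, and, with principal complex square roots, $$a_4=\frac{-\phi-\sqrt{\phi^2-4(\delta p+\lambda r)(\lambda q+\sigma s)}}{2(\delta p+\lambda r)},\quad a_3=\frac{-4\mathcal G_4+9\mathcal G_3-6\mathcal G_2+\mathcal G_1}{\mathcal G_4-3\mathcal G_3+3\mathcal G_2-\mathcal G_1},\quad a_2=\frac{\mathcal L_4}2-\mathcal L_3+\frac{\mathcal L_2}2,$$ $$a_5=\frac{\kappa-\sqrt{\kappa^2-4\eta}}2-1,\quad a_6=\frac{\kappa+\sqrt{\kappa^2-4\eta}}2-1,\quad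 \tau=\frac{\Gamma(a_3+1)\Gamma(a_4+1)}{\Gamma(a_5+1)\Gamma(a_6+1)},\quad a_1=\frac{\tau}{a_2},$$ where $\mathcal G_i=\varphi_i(a_4+i)$, $\mathcal L_i=\varphi_i(a_4+i)(a_3+i)$, $\kappa=\frac{\mathcal L_2-\mathcal L_1}{a_2}-1$, $\eta=\frac{\mathcal L_1}{a_2}$. Put $m=1$ if $a_5<a_6$ and $m=2$ if $a_5>a_6$, so that $a_{m+4}=\min(a_5,a_6)$, and $$b_0^{(k)}=\frac{\Gamma(1+a_{k+4})\,\Gamma((3-2k)(a_6-a_5))}{\Gamma(a_3-a_{k+4})\,\Gamma(a_4-a_{k+4})},\qquad k=1,2 .$$ Assume, for every $\mu_1>0$, that the denominators of $a_3$ and $a_4$ do not vanish, that $a_2>0$, that $a_5\neq a_6$ are real and $>-1$, and that none of $a_3+1$, $a_4+1$, $a_3-a_{m+4}$, $a_4-a_{m+4}$ is a non-positive integer ($a_3,a_4$ may be complex). The approximate moment generating function of the branch is $$M_\gamma(s)=\frac{a_1}{s}\,G^{2,1}_{3,2}\Big(\tfrac1{sa_2}\Big|{0;\,a_3,a_4\atop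 a_5,a_6;\,-}\Big),\qquad s>0 .$$ Let $N\ge1$, $\rho,\theta>0$. The (approximate) average symbol error rate (ASER) of an $N$-branch maximal-ratio-combining receiver is $\overline P_s=\frac{2\rho}{\pi}\int_0^{\pi/2}M_{\gamma_T}\big(\theta/\sin^2 t\big)\,dt$, with $M_{\gamma_T}=M_\gamma^N$ in the i.i.d. case and $M_{\gamma_T}=\prod_{j=1}^N M_{\gamma_j}$ in the i.n.i.d. case, where branch $j$ has its own parameters and its own average SNR $\mu_1^{(j)}$; a further index $j$ on a quantity refers to branch $j$. Below, $u\sim v$ means $u/v\to1$, and $\mathcal B$ is the Beta function. **Statement.** (i) In the i.i.d. case the quantities $$G_d=N(a_{m+4}+1)=N(\min(a_5,a_6)+1),$$ $$G_c=\frac{\rho}{\pi}\Big(\big(\tfrac4\theta\big)^{a_{m+4}+1}\tau\, b_0^{(m)}\Big)^N\mathcal B\big(N(a_{m+4}+1)+\tfrac12,\;N(a_{m+4}+1)+\tfrac12\big)$$ do not depend on $\mu_1$, and as $\mu_1\to\infty$ $$\overline P_s\sim G_c\,a_2^{-G_d};$$ moreover $G_d$ is the diversity order: $-\log|\overline P_s|/\log\mu_1\to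 G_d$. (ii) In the i.n.i.d. case let $g_j\in\{1,2\}$ be the index with $a_{g_j+4,j}=\min(a_{5,j},a_{6,j})$ and $\zeta=\sum_{j=1}^N a_{g_j+4,j}$. Then, as $\mu_1^{(j)}\to\infty$ for all $j$ jointly, $$\overline P_s\sim\frac{\rho}{\pi}\,\mathcal B\big(\zeta+N+\tfrac12,\;\zeta+N+\tfrac12\big)\Big(\frac4\theta\Big)^{\zeta+N}\prod_{j=1}^N\Big(b_{0,j}^{(g_j)}\,\tau^{(j)}\,a_{2,j}^{-a_{g_j+4,j}-1}\Big).$$ -/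

import Mathlib

open Filter Topology Asymptotics

noncomputable section

/-! ### Meijer's G-function on the positive half-line -/

/-- The Mellin-Barnes kernel of `G^{m,n}_{p,q}( · | an ; ap / bm ; bq)`, where `an`, `ap` are the
upper parameters before and after the semicolon and `bm`, `bq` the lower ones.  (`1 / Γ` is entire
and vanishes at the poles of `Γ`, which agrees with the conventions of `Complex.Gamma` and `/`.) -/
def meijerKernel (an ap bm bq : List ℂ) (s : ℂ) : ℂ :=
  ((bm.map fun b => Complex.Gamma (b + s)).prod *
      (an.map fun a => Complex.Gamma (1 - a - s)).prod) /
    ((ap.map fun a => Complex.Gamma (a + s)).prod *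
      (bq.map fun b => Complex.Gamma (1 - b - s)).prod)

/-- The vertical line `Re s = c` separates the poles of the `Γ (b + s)` (on its left) from the
poles of the `Γ (1 - a - s)` (on its right). -/
def MeijerSeparates (an bm : List ℂ) (c : ℝ) : Prop :=
  (∀ b ∈ bm, -b.re < c) ∧ (∀ a ∈ an, c < 1 - a.re)

/-- Abscissa of the Mellin-Barnes contour: any separating abscissa.  By Cauchy's theorem the value
of the integral below does not depend on which one is taken. -/
def meijerAbscissa (an bm : List ℂ) : ℝ :=
  Classical.epsilon (MeijerSeparates an bm)

/-- Meijer's `G`-function `G^{m,n}_{p,q}(z | an ; ap / bm ; bq)` for `z > 0`, that is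
`(1 / 2πi) ∫ kernel(s) z^{-s} ds` along the vertical line through `meijerAbscissa`.
(The standard contour `L_{iγ∞}`, with absolute convergence for `m + n > (p + q) / 2`; this holds for
the two functions `G^{3,0}_{1,3}` and `G^{2,1}_{3,2}` used below.) -/
def meijerG (an ap bm bq : List ℂ) (z : ℝ) : ℂ :=
  (1 / (2 * (Real.pi : ℂ))) *
    ∫ t : ℝ, meijerKernel an ap bm bq ((meijerAbscissa an bm : ℂ) + t * Complex.I) *
      (z : ℂ) ^ (-((meijerAbscissa an bm : ℂ) + t * Complex.I))

/-! ### The Málaga distribution with pointing errors -/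

/-- Parameters of a Málaga-`M` fading branch with pointing errors, except for its average SNR. -/
structure Malaga where
  /-- turbulence severity -/
  α : ℝ
  /-- turbulence severity (a positive integer) -/
  β : ℕ
  /-- pointing error severity -/
  ξ : ℝ
  /-- average power of the dominant line-of-sight component -/
  Ω : ℝ
  /-- `2 d₀` is the average power of the total scatter components -/
  d₀ : ℝ
  /-- amount of scattering power coupled to the line-of-sight component -/
  ε : ℝ
  /-- phase of the line-of-sight component -/
  ΘA : ℝ
  /-- phase of the coupled-to-line-of-sight component -/
  ΘB : ℝ
  α_pos : 0 < α
  β_pos : 1 ≤ β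
  ξ_pos : 0 < ξ
  Ω_nonneg : 0 ≤ Ω
  d₀_pos : 0 < d₀
  ε_nonneg : 0 ≤ ε
  ε_lt_one : ε < 1

namespace Malaga

variable (P : Malaga)

/-- `h = 2 d₀ (1 - ε)` -/
def h : ℝ := 2 * P.d₀ * (1 - P.ε)

/-- `Ω' = Ω + 2 d₀ ε + 2 √(2 d₀ ε Ω) cos (Θ_A - Θ_B)` -/
def Ω' : ℝ :=
  P.Ω + 2 * P.d₀ * P.ε + 2 * Real.sqrt (2 * P.d₀ * P.ε * P.Ω) * Real.cos (P.ΘA - P.ΘB)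

/-- The constant `A` of the density. -/
def A : ℝ :=
  2 * P.α ^ (P.α / 2) / (P.h ^ (1 + P.α / 2) * Real.Gamma P.α) *
    ((P.β : ℝ) / (P.β + P.Ω' / P.h)) ^ ((P.β : ℝ) + P.α / 2)

/-- The constant `B` of the density. -/
def B : ℝ :=
  P.ξ ^ 2 * P.α * P.β * (P.h + P.Ω') / ((P.ξ ^ 2 + 1) * (P.h * P.β + P.Ω'))

/-- The weights `b_m`, `1 ≤ m ≤ β`, of the density. -/
def weight (m : ℕ) : ℝ :=
  ((P.β - 1).choose (m - 1) : ℝ) * (P.h * P.β + P.Ω') ^ (1 + P.α / 2) /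
      ((m - 1).factorial : ℝ) *
    (P.Ω' / P.h) ^ (m - 1) * (P.β : ℝ) ^ (-(P.α / 2) - (m : ℝ)) * P.α ^ (-(P.α / 2))

/-- The density `f_γ(x)`, `x > 0`, of the branch SNR `γ` with average `μ₁`.  (The parameters of the
`G`-function are real and its argument is positive, so its value is real.) -/
def pdf (μ₁ x : ℝ) : ℝ :=
  P.ξ ^ 2 * P.A / (2 * x) *
    ∑ m ∈ Finset.Icc 1 P.β, P.weight m *
      (meijerG [] [((P.ξ ^ 2 + 1 : ℝ) : ℂ)] [((P.ξ ^ 2 : ℝ) : ℂ), (P.α : ℂ), (m : ℂ)] []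
        (P.B * x / μ₁)).re

/-- The `i`-th moment `μ_i` of `γ`. -/
def moment (μ₁ : ℝ) (i : ℕ) : ℝ := ∫ x in Set.Ioi (0 : ℝ), x ^ i * P.pdf μ₁ x

/-- `φ_i = μ_i / μ_{i-1}`, `i ≥ 1` -/
def ratio (μ₁ : ℝ) (i : ℕ) : ℝ := P.moment μ₁ i / P.moment μ₁ (i - 1)

/-! ### The six parameters of the moment-matched approximation -/

/-- `λ` -/
def lam (μ₁ : ℝ) : ℝ :=
  5 * P.ratio μ₁ 5 - 12 * P.ratio μ₁ 4 + 9 * P.ratio μ₁ 3 - 2 * P.ratio μ₁ 2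

/-- `p` -/
def p (μ₁ : ℝ) : ℝ :=
  -4 * P.ratio μ₁ 4 + 9 * P.ratio μ₁ 3 - 6 * P.ratio μ₁ 2 + P.moment μ₁ 1

/-- `s` -/
def s (μ₁ : ℝ) : ℝ :=
  4 * P.ratio μ₁ 4 - 9 * P.ratio μ₁ 3 + 6 * P.ratio μ₁ 2 - P.moment μ₁ 1

/-- `σ` -/
def sig (μ₁ : ℝ) : ℝ :=
  25 * P.ratio μ₁ 5 - 48 * P.ratio μ₁ 4 + 27 * P.ratio μ₁ 3 - 4 * P.ratio μ₁ 2

/-- `r` -/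
def r (μ₁ : ℝ) : ℝ :=
  P.ratio μ₁ 4 - 3 * P.ratio μ₁ 3 + 3 * P.ratio μ₁ 2 - P.moment μ₁ 1

/-- `δ` -/
def del (μ₁ : ℝ) : ℝ :=
  P.ratio μ₁ 5 - 3 * P.ratio μ₁ 4 + 3 * P.ratio μ₁ 3 - P.ratio μ₁ 2

/-- `q` -/
def q (μ₁ : ℝ) : ℝ :=
  P.moment μ₁ 1 - 16 * P.ratio μ₁ 4 + 27 * P.ratio μ₁ 3 - 12 * P.ratio μ₁ 2

/-- `ϕ` -/
def phi (μ₁ : ℝ) : ℝ :=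
  P.lam μ₁ * (P.p μ₁ + P.s μ₁) + P.sig μ₁ * P.r μ₁ + P.del μ₁ * P.q μ₁

/-- The denominator `δ p + λ r` occurring in `a₄`. -/
def den₄ (μ₁ : ℝ) : ℝ := P.del μ₁ * P.p μ₁ + P.lam μ₁ * P.r μ₁

/-- `a₄`.  The discriminant may be negative, in which case `a₃`, `a₄` are complex conjugates; the
square root is the principal one. -/
def a₄ (μ₁ : ℝ) : ℂ :=
  (-(P.phi μ₁ : ℂ) -
      ((P.phi μ₁ ^ 2 - 4 * P.den₄ μ₁ * (P.lam μ₁ * P.q μ₁ + P.sig μ₁ * P.s μ₁) : ℝ) : ℂ)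
        ^ (1 / 2 : ℂ)) /
    (2 * (P.den₄ μ₁ : ℂ))

/-- `𝒢_i = φ_i (a₄ + i)` -/
def G (μ₁ : ℝ) (i : ℕ) : ℂ := (P.ratio μ₁ i : ℂ) * (P.a₄ μ₁ + i)

/-- The denominator occurring in `a₃`. -/
def den₃ (μ₁ : ℝ) : ℂ := P.G μ₁ 4 - 3 * P.G μ₁ 3 + 3 * P.G μ₁ 2 - P.G μ₁ 1

/-- `a₃` -/
def a₃ (μ₁ : ℝ) : ℂ :=
  (-4 * P.G μ₁ 4 + 9 * P.G μ₁ 3 - 6 * P.G μ₁ 2 + P.G μ₁ 1) / P.den₃ μ₁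

/-- `ℒ_i = φ_i (a₄ + i) (a₃ + i)` -/
def L (μ₁ : ℝ) (i : ℕ) : ℂ := (P.ratio μ₁ i : ℂ) * (P.a₄ μ₁ + i) * (P.a₃ μ₁ + i)

/-- `a₂` -/
def a₂ (μ₁ : ℝ) : ℂ := P.L μ₁ 4 / 2 - P.L μ₁ 3 + P.L μ₁ 2 / 2

/-- `κ` -/
def kap (μ₁ : ℝ) : ℂ := (P.L μ₁ 2 - P.L μ₁ 1) / P.a₂ μ₁ - 1

/-- `η` -/
def eta (μ₁ : ℝ) : ℂ := P.L μ₁ 1 / P.a₂ μ₁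

/-- `a₅` -/
def a₅ (μ₁ : ℝ) : ℂ :=
  (P.kap μ₁ - (P.kap μ₁ ^ 2 - 4 * P.eta μ₁) ^ (1 / 2 : ℂ)) / 2 - 1

/-- `a₆` -/
def a₆ (μ₁ : ℝ) : ℂ :=
  (P.kap μ₁ + (P.kap μ₁ ^ 2 - 4 * P.eta μ₁) ^ (1 / 2 : ℂ)) / 2 - 1

/-- `a_{k+4}` for `k = 1, 2` -/
def aExp (μ₁ : ℝ) (k : ℕ) : ℂ := if k = 1 then P.a₅ μ₁ else P.a₆ μ₁

/-- The index `m` (also written `g`) of the smaller one of `a₅`, `a₆`. -/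
def minIdx (μ₁ : ℝ) : ℕ := if (P.a₅ μ₁).re < (P.a₆ μ₁).re then 1 else 2

/-- `τ = Γ(a₃ + 1) Γ(a₄ + 1) / (Γ(a₅ + 1) Γ(a₆ + 1))` -/
def tau (μ₁ : ℝ) : ℂ :=
  Complex.Gamma (P.a₃ μ₁ + 1) * Complex.Gamma (P.a₄ μ₁ + 1) /
    (Complex.Gamma (P.a₅ μ₁ + 1) * Complex.Gamma (P.a₆ μ₁ + 1))

/-- `a₁ = Γ(a₃ + 1) Γ(a₄ + 1) / (a₂ Γ(a₅ + 1) Γ(a₆ + 1))` -/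
def a₁ (μ₁ : ℝ) : ℂ :=
  Complex.Gamma (P.a₃ μ₁ + 1) * Complex.Gamma (P.a₄ μ₁ + 1) /
    (P.a₂ μ₁ * Complex.Gamma (P.a₅ μ₁ + 1) * Complex.Gamma (P.a₆ μ₁ + 1))

/-- The coefficients `b_l^{(k)}`, `k = 1, 2`. -/
def b (μ₁ : ℝ) (k l : ℕ) : ℂ :=
  (-1) ^ l * Complex.Gamma (1 + P.aExp μ₁ k + l) *
      Complex.Gamma ((3 - 2 * (k : ℂ)) * (P.a₆ μ₁ - P.a₅ μ₁) - l) /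
    ((l.factorial : ℂ) * Complex.Gamma (P.a₃ μ₁ - P.aExp μ₁ k - l) *
      Complex.Gamma (P.a₄ μ₁ - P.aExp μ₁ k - l) * P.a₂ μ₁ ^ l)

/-- The approximation is well defined at average SNR `μ₁`: the denominators in `a₃`, `a₄` do not
vanish, the scale `a₂` is positive, the exponents `a₅ ≠ a₆` are real and `> -1`, and none of
`Γ(a₃ + 1)`, `Γ(a₄ + 1)` and the Gamma functions in the denominator of `b_0^{(m)}` is taken at a
pole. -/
structure Admissible (μ₁ : ℝ) : Prop where
  den₄_ne : P.den₄ μ₁ ≠ 0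
  den₃_ne : P.den₃ μ₁ ≠ 0
  a₂_im : (P.a₂ μ₁).im = 0
  a₂_pos : 0 < (P.a₂ μ₁).re
  a₅_im : (P.a₅ μ₁).im = 0
  a₆_im : (P.a₆ μ₁).im = 0
  a₅_gt : -1 < (P.a₅ μ₁).re
  a₆_gt : -1 < (P.a₆ μ₁).re
  a₅_ne_a₆ : P.a₅ μ₁ ≠ P.a₆ μ₁
  a₃_ne : ∀ n : ℕ, P.a₃ μ₁ + 1 ≠ -(n : ℂ)
  a₄_ne : ∀ n : ℕ, P.a₄ μ₁ + 1 ≠ -(n : ℂ)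
  a₃_sub_ne : ∀ n : ℕ, P.a₃ μ₁ - P.aExp μ₁ (P.minIdx μ₁) ≠ -(n : ℂ)
  a₄_sub_ne : ∀ n : ℕ, P.a₄ μ₁ - P.aExp μ₁ (P.minIdx μ₁) ≠ -(n : ℂ)

/-- The approximate moment generating function of a branch,
`M_γ(s) = (a₁ / s) G^{2,1}_{3,2}(1 / (s a₂) | 0 ; a₃, a₄ / a₅, a₆ ; -)`, `s > 0`
(with `a₂ > 0`). -/
def mgf (μ₁ x : ℝ) : ℂ :=
  P.a₁ μ₁ / x * meijerG [0] [P.a₃ μ₁, P.a₄ μ₁] [P.a₅ μ₁, P.a₆ μ₁] [] (1 / (x * (P.a₂ μ₁).re))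

/-- The coding gain of `N` i.i.d. branches. -/
def codingGain (ρ θ : ℝ) (N : ℕ) (μ₁ : ℝ) : ℂ :=
  (ρ / Real.pi : ℂ) *
    ((4 / θ : ℂ) ^ (P.aExp μ₁ (P.minIdx μ₁) + 1) * P.tau μ₁ * P.b μ₁ (P.minIdx μ₁) 0) ^ N *
    Complex.betaIntegral (N * (P.aExp μ₁ (P.minIdx μ₁) + 1) + 1 / 2)
      (N * (P.aExp μ₁ (P.minIdx μ₁) + 1) + 1 / 2)

end Malaga

/-! ### The average symbol error rate -/

/-- `(2ρ/π) ∫_0^{π/2} M(θ / sin² φ) dφ`, where `M` is the MGF of the combined SNR. -/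
def aserOfMgf (ρ θ : ℝ) (M : ℝ → ℂ) : ℂ :=
  (2 * ρ / Real.pi : ℂ) * ∫ t in (0 : ℝ)..(Real.pi / 2), M (θ / Real.sin t ^ 2)

/-- The (approximate) ASER with `N` i.i.d. branches of average SNR `μ₁`: the MGF of the sum of the
branch SNRs is the `N`-th power of the MGF of a branch. -/
def aserIID (ρ θ : ℝ) (N : ℕ) (P : Malaga) (μ₁ : ℝ) : ℂ :=
  aserOfMgf ρ θ fun x => P.mgf μ₁ x ^ N

/-- The (approximate) ASER with `N` independent branches of parameters `P j` and average SNRs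
`μ₁ j`: the MGF of the sum of the branch SNRs is the product of the MGFs of the branches. -/
def aserINID (ρ θ : ℝ) {N : ℕ} (P : Fin N → Malaga) (μ₁ : Fin N → ℝ) : ℂ :=
  aserOfMgf ρ θ fun x => ∏ j, (P j).mgf (μ₁ j) x

/-- `ζ = ∑_j a_{g_j+4,j}` -/
def zetaSum {N : ℕ} (P : Fin N → Malaga) (μ₁ : Fin N → ℝ) : ℂ :=
  ∑ j, (P j).aExp (μ₁ j) ((P j).minIdx (μ₁ j))

/-- The high-SNR approximation of the ASER with `N` independent branches. -/
def aserINIDAsymptotic (ρ θ : ℝ) {N : ℕ} (P : Fin N → Malaga) (μ₁ : Fin N → ℝ) : ℂ :=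
  (ρ / Real.pi : ℂ) *
    Complex.betaIntegral (zetaSum P μ₁ + N + 1 / 2) (zetaSum P μ₁ + N + 1 / 2) *
    (4 / θ : ℂ) ^ (zetaSum P μ₁ + N) *
    ∏ j, ((P j).b (μ₁ j) ((P j).minIdx (μ₁ j)) 0 * (P j).tau (μ₁ j) *
      (P j).a₂ (μ₁ j) ^ (-(P j).aExp (μ₁ j) ((P j).minIdx (μ₁ j)) - 1))

end

noncomputable section

namespace Malaga

variable (P : Malaga)

/-! ### Scaling in the average SNR -/

/-! The average SNR is a pure scale parameter: the density sees `x` only through `x / μ₁`, up to the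
factor `1 / x`. Hence the `i`-th moment is homogeneous of degree `i` in `μ₁` and each `φ_i` of
degree 1. The formulas for `a₃`, `a₄`, `a₅`, `a₆` are homogeneous of degree 0 in these data, so they
are constants, as are `τ` and `b_0`, while `a₂` is linear in `μ₁`. With `z = 1 / (x a₂)` the branch
MGF is therefore `τ z G(z)` for one fixed Meijer function `G`, and high SNR means `z → 0+`
(`exists_expansion`).

Near 0, `G` is governed by the first pole to the left of the contour, at `s = -u` with `u = min(a₅,
a₆)`. In place of the residue theorem, `R Γ(u + s)` is subtracted from the kernel, `R` being the
cofactor of `Γ(u + s)` at the pole. Its inverse Mellin transform is exactly `R z^u e^{-z}`, and the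
difference is holomorphic across the pole, so its contour moves further left and contributes only
`O(z^{-d})` with `-d > u` (`tendsto_meijerLine_div`). This `R` is `b_0` of the smaller exponent,
nonzero by admissibility. Moving the contour needs exponential decay on vertical strips. It comes
from the exact value of `|Γ|` on `Re s = 1/2`, carried along horizontal lines by the Beta integral,
without Stirling's formula.

At `x = θ / sin² t` the argument is `z = sin² t / (θ a₂)`, so each branch contributes `sin^{2(u+1)}
t` times a factor converging boundedly to a constant. Dominated convergence leaves `∫ sin^{2w}`,
which is the Beta value. The i.i.d. case is the diagonal of the i.n.i.d. one, and the diversity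
order follows by taking logarithms. -/

lemma pdf_scale {μ : ℝ} (hμ : 0 < μ) (x : ℝ) : P.pdf μ (μ * x) = μ⁻¹ * P.pdf 1 x := by
  have h : P.B * (μ * x) / μ = P.B * x / 1 := by field_simp
  have h2 : P.ξ ^ 2 * P.A / (2 * (μ * x)) = μ⁻¹ * (P.ξ ^ 2 * P.A / (2 * x)) := by
    rw [show 2 * (μ * x) = μ * (2 * x) by ring, mul_comm μ, ← div_div, inv_mul_eq_div]
  unfold pdf
  rw [h, h2, mul_assoc]

/-- Substitution `x ↦ μ x`. The identity needs no convergence of the moments: if an integral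
diverges, both sides take the default value 0. -/
lemma moment_scale {μ : ℝ} (hμ : 0 < μ) (i : ℕ) : P.moment μ i = μ ^ i * P.moment 1 i := by
  have h := MeasureTheory.integral_comp_mul_left_Ioi (fun x => x ^ i * P.pdf μ x) 0 hμ
  rw [mul_zero, smul_eq_mul] at h
  unfold moment
  rw [show ∫ x in Set.Ioi (0 : ℝ), x ^ i * P.pdf μ x =
    μ * ∫ x in Set.Ioi (0 : ℝ), (μ * x) ^ i * P.pdf μ (μ * x) by rw [h]; field_simp,
    ← MeasureTheory.integral_const_mul, ← MeasureTheory.integral_const_mul]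
  refine MeasureTheory.integral_congr_ae (Eventually.of_forall fun x => ?_)
  simp only [P.pdf_scale hμ, mul_pow]
  field_simp

/-- The shifted index excludes `ratio μ 0`, which by truncated subtraction is `moment μ 0 / moment μ
0` and does not scale. A vanishing denominator is harmless. -/
lemma ratio_scale {μ : ℝ} (hμ : 0 < μ) (i : ℕ) :
    P.ratio μ (i + 1) = μ * P.ratio 1 (i + 1) := by
  unfold ratio
  rw [P.moment_scale hμ, P.moment_scale hμ (i + 1 - 1), Nat.add_sub_cancel, pow_succ,
    mul_assoc, mul_div_mul_left _ _ (pow_pos hμ i).ne', mul_div_assoc]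

lemma a₄_scale {μ : ℝ} (hμ : 0 < μ) : P.a₄ μ = P.a₄ 1 := by
  have h1 : P.moment μ 1 = μ * P.moment 1 1 := by rw [P.moment_scale hμ, pow_one]
  have h2 := P.ratio_scale hμ 1
  have h3 := P.ratio_scale hμ 2
  have h4 := P.ratio_scale hμ 3
  have h5 := P.ratio_scale hμ 4
  norm_num at h2 h3 h4 h5
  have hlam : P.lam μ = μ * P.lam 1 := by unfold lam; rw [h2, h3, h4, h5]; ring
  have hp : P.p μ = μ * P.p 1 := by unfold p; rw [h1, h2, h3, h4]; ring
  have hs : P.s μ = μ * P.s 1 := by unfold s; rw [h1, h2, h3, h4]; ring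
  have hsig : P.sig μ = μ * P.sig 1 := by unfold sig; rw [h2, h3, h4, h5]; ring
  have hr : P.r μ = μ * P.r 1 := by unfold r; rw [h1, h2, h3, h4]; ring
  have hdel : P.del μ = μ * P.del 1 := by unfold del; rw [h2, h3, h4, h5]; ring
  have hq : P.q μ = μ * P.q 1 := by unfold q; rw [h1, h2, h3, h4]; ring
  have hphi : P.phi μ = μ ^ 2 * P.phi 1 := by
    unfold phi; rw [hlam, hp, hs, hsig, hr, hdel, hq]; ring
  have hden : P.den₄ μ = μ ^ 2 * P.den₄ 1 := by
    unfold den₄; rw [hlam, hp, hr, hdel]; ring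
  have hdisc : P.phi μ ^ 2 - 4 * P.den₄ μ * (P.lam μ * P.q μ + P.sig μ * P.s μ) =
      (μ ^ 2) ^ 2 * (P.phi 1 ^ 2 - 4 * P.den₄ 1 * (P.lam 1 * P.q 1 + P.sig 1 * P.s 1)) := by
    rw [hphi, hden, hlam, hq, hsig, hs]; ring
  -- The discriminant has degree 4. A positive factor leaves the argument of `D` unchanged, so it
  -- comes out of the principal root even for `D < 0`.
  have hsqrt : ∀ D : ℝ, (((μ ^ 2) ^ 2 * D : ℝ) : ℂ) ^ (1 / 2 : ℂ) =
      ((μ ^ 2 : ℝ) : ℂ) * (D : ℂ) ^ (1 / 2 : ℂ) := by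
    intro D
    have hpos : (0 : ℝ) < (μ ^ 2) ^ 2 := by positivity
    rcases eq_or_ne D 0 with rfl | hD
    · simp
    have hD' : (D : ℂ) ≠ 0 := by exact_mod_cast hD
    have hpos' : (((μ ^ 2) ^ 2 : ℝ) : ℂ) ≠ 0 := by exact_mod_cast hpos.ne'
    rw [Complex.ofReal_mul, Complex.cpow_def_of_ne_zero (mul_ne_zero hpos' hD'),
      Complex.log_ofReal_mul hpos hD', Complex.cpow_def_of_ne_zero hD', add_mul, Complex.exp_add]
    congr 1
    rw [Real.log_pow, show ((2 : ℕ) * Real.log (μ ^ 2) : ℝ) = 2 * Real.log (μ ^ 2) by norm_num,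
      Complex.ofReal_mul, mul_comm ((2 : ℝ) : ℂ), mul_assoc]
    norm_num
    rw [two_mul, Complex.exp_add, ← Complex.ofReal_exp, Real.exp_log hμ, sq]
  unfold a₄
  rw [hdisc, hsqrt, hphi, hden]
  have hμ2 : ((μ ^ 2 : ℝ) : ℂ) ≠ 0 := by exact_mod_cast (pow_pos hμ 2).ne'
  rw [← mul_div_mul_left _ (2 * (P.den₄ 1 : ℂ)) hμ2]
  congr 1 <;> push_cast <;> ring

lemma G_scale {μ : ℝ} (hμ : 0 < μ) (i : ℕ) : P.G μ (i + 1) = μ * P.G 1 (i + 1) := by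
  unfold G
  rw [P.ratio_scale hμ, P.a₄_scale hμ]
  push_cast
  ring

lemma a₃_scale {μ : ℝ} (hμ : 0 < μ) : P.a₃ μ = P.a₃ 1 := by
  have h1 := P.G_scale hμ 0
  have h2 := P.G_scale hμ 1
  have h3 := P.G_scale hμ 2
  have h4 := P.G_scale hμ 3
  norm_num at h1 h2 h3 h4
  have hμ0 : (μ : ℂ) ≠ 0 := by exact_mod_cast hμ.ne'
  unfold a₃ den₃
  rw [← mul_div_mul_left _ (P.G 1 4 - 3 * P.G 1 3 + 3 * P.G 1 2 - P.G 1 1) hμ0, h1, h2, h3, h4]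
  congr 1 <;> ring

lemma L_scale {μ : ℝ} (hμ : 0 < μ) (i : ℕ) : P.L μ (i + 1) = μ * P.L 1 (i + 1) := by
  unfold L
  rw [P.ratio_scale hμ, P.a₄_scale hμ, P.a₃_scale hμ]
  push_cast
  ring

lemma a₂_scale {μ : ℝ} (hμ : 0 < μ) : P.a₂ μ = μ * P.a₂ 1 := by
  have h2 := P.L_scale hμ 1
  have h3 := P.L_scale hμ 2
  have h4 := P.L_scale hμ 3
  norm_num at h2 h3 h4
  unfold a₂
  rw [h2, h3, h4]
  ring

lemma kap_scale {μ : ℝ} (hμ : 0 < μ) : P.kap μ = P.kap 1 := by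
  have h1 := P.L_scale hμ 0
  have h2 := P.L_scale hμ 1
  norm_num at h1 h2
  have hμ0 : (μ : ℂ) ≠ 0 := by exact_mod_cast hμ.ne'
  unfold kap
  rw [h1, h2, P.a₂_scale hμ, ← mul_sub, mul_div_mul_left _ _ hμ0]

lemma eta_scale {μ : ℝ} (hμ : 0 < μ) : P.eta μ = P.eta 1 := by
  have h1 := P.L_scale hμ 0
  norm_num at h1
  have hμ0 : (μ : ℂ) ≠ 0 := by exact_mod_cast hμ.ne'
  unfold eta
  rw [h1, P.a₂_scale hμ, mul_div_mul_left _ _ hμ0]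

lemma a₅_scale {μ : ℝ} (hμ : 0 < μ) : P.a₅ μ = P.a₅ 1 := by
  unfold a₅; rw [P.kap_scale hμ, P.eta_scale hμ]

lemma a₆_scale {μ : ℝ} (hμ : 0 < μ) : P.a₆ μ = P.a₆ 1 := by
  unfold a₆; rw [P.kap_scale hμ, P.eta_scale hμ]

lemma minIdx_scale {μ : ℝ} (hμ : 0 < μ) : P.minIdx μ = P.minIdx 1 := by
  unfold minIdx; rw [P.a₅_scale hμ, P.a₆_scale hμ]

lemma aExp_scale {μ : ℝ} (hμ : 0 < μ) (k : ℕ) : P.aExp μ k = P.aExp 1 k := by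
  unfold aExp; rw [P.a₅_scale hμ, P.a₆_scale hμ]

lemma tau_scale {μ : ℝ} (hμ : 0 < μ) : P.tau μ = P.tau 1 := by
  unfold tau; rw [P.a₃_scale hμ, P.a₄_scale hμ, P.a₅_scale hμ, P.a₆_scale hμ]

/-- Restricted to `l = 0`, where the factor `a₂ ^ l`, which does depend on `μ`, disappears. -/
lemma b_zero_scale {μ : ℝ} (hμ : 0 < μ) (k : ℕ) : P.b μ k 0 = P.b 1 k 0 := by
  unfold b
  simp only [pow_zero, P.a₃_scale hμ, P.a₄_scale hμ, P.a₅_scale hμ, P.a₆_scale hμ,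
    P.aExp_scale hμ]

lemma codingGain_scale {μ : ℝ} (hμ : 0 < μ) (ρ θ : ℝ) (N : ℕ) :
    P.codingGain ρ θ N μ = P.codingGain ρ θ N 1 := by
  unfold codingGain
  rw [P.minIdx_scale hμ, P.aExp_scale hμ, P.tau_scale hμ, P.b_zero_scale hμ]

end Malaga

/-! ### Vertical growth of the Gamma function -/

/-- Triangle inequality under the integral: `|x^{s-1}|` depends only on `Re s`. -/
lemma Complex.norm_betaIntegral_ofReal_le {s : ℂ} (hs : 0 < s.re) {v : ℝ} (hv : 0 < v) :
    ‖Complex.betaIntegral s v‖ ≤ ‖Complex.betaIntegral (s.re : ℂ) v‖ := by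
  have hnorm : ∀ w : ℂ, ∀ x ∈ Set.Ioo (0 : ℝ) 1,
      ‖(x : ℂ) ^ (w - 1) * (1 - (x : ℂ)) ^ ((v : ℂ) - 1)‖ = x ^ (w.re - 1) * (1 - x) ^ (v - 1) := by
    intro w x hx
    have h1 : (0 : ℝ) < 1 - x := by linarith [hx.2]
    rw [norm_mul, Complex.norm_cpow_eq_rpow_re_of_pos hx.1,
      show (1 - (x : ℂ)) = ((1 - x : ℝ) : ℂ) by push_cast; ring,
      Complex.norm_cpow_eq_rpow_re_of_pos h1]
    simp
  have hreal : Complex.betaIntegral (s.re : ℂ) v =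
      ((∫ x in (0 : ℝ)..1, x ^ (s.re - 1) * (1 - x) ^ (v - 1) : ℝ) : ℂ) := by
    rw [Complex.betaIntegral, ← intervalIntegral.integral_ofReal]
    refine intervalIntegral.integral_congr fun x hx => ?_
    rw [Set.uIcc_of_le zero_le_one] at hx
    have h1 : (0 : ℝ) ≤ 1 - x := by linarith [hx.2]
    rw [Complex.ofReal_mul, Complex.ofReal_cpow hx.1, Complex.ofReal_cpow h1]
    push_cast
    rfl
  have hint : IntervalIntegrable (fun x : ℝ => x ^ (s.re - 1) * (1 - x) ^ (v - 1))
      MeasureTheory.volume 0 1 := by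
    have h := (Complex.betaIntegral_convergent (u := (s.re : ℂ)) (v := v) (by simpa) (by simpa)).norm
    refine h.congr_ae ?_
    rw [Set.uIoc_of_le zero_le_one, MeasureTheory.Measure.restrict_congr_set
      MeasureTheory.Ioo_ae_eq_Ioc.symm]
    refine (MeasureTheory.ae_restrict_iff' measurableSet_Ioo).2 (Eventually.of_forall fun x hx => ?_)
    simpa using hnorm (s.re : ℂ) x hx
  have hle : ‖Complex.betaIntegral s v‖ ≤ ∫ x in (0 : ℝ)..1, x ^ (s.re - 1) * (1 - x) ^ (v - 1) := by
    refine intervalIntegral.norm_integral_le_of_norm_le zero_le_one ?_ hint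
    have : ∀ᵐ x : ℝ, x ≠ 1 := by simp [MeasureTheory.ae_iff, MeasureTheory.measure_singleton]
    filter_upwards [this] with x hx1 hx
    exact (hnorm s x ⟨hx.1, lt_of_le_of_ne hx.2 hx1⟩).le
  rw [hreal, Complex.norm_real]
  exact hle.trans (le_abs_self _)

/-- On a horizontal line the ratio `|Γ(x + iy)| / Γ(x)` increases with `x`. -/
lemma Complex.norm_Gamma_mul_Gamma_le {s : ℂ} (hs : 0 < s.re) {v : ℝ} (hv : 0 < v) :
    ‖Complex.Gamma s‖ * Real.Gamma (s.re + v) ≤ ‖Complex.Gamma (s + v)‖ * Real.Gamma s.re := by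
  have hvp := Real.Gamma_pos_of_pos hv
  -- `Γ(s) Γ(v) = Γ(s + v) B(s, v)`, used at `s` and at `Re s`; the two Beta values are compared by
  -- the previous lemma.
  have h1 := Complex.Gamma_mul_Gamma_eq_betaIntegral hs (t := (v : ℂ)) (by simpa)
  have h2 := Complex.Gamma_mul_Gamma_eq_betaIntegral (s := (s.re : ℂ)) (by simpa) (t := (v : ℂ))
    (by simpa)
  have h1' := congrArg norm h1
  have h2' := congrArg norm h2
  rw [← Complex.ofReal_add] at h2'
  simp only [norm_mul, Complex.Gamma_ofReal, Complex.norm_real, Real.norm_eq_abs] at h1' h2'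
  rw [abs_of_pos hvp, abs_of_pos (Real.Gamma_pos_of_pos hs),
    abs_of_pos (Real.Gamma_pos_of_pos (add_pos hs hv))] at h2'
  rw [abs_of_pos hvp] at h1'
  have hb := Complex.norm_betaIntegral_ofReal_le hs hv
  have hG := Real.Gamma_pos_of_pos (add_pos hs hv)
  refine le_of_mul_le_mul_right ?_ hvp
  calc _ = (‖Complex.Gamma s‖ * Real.Gamma v) * Real.Gamma (s.re + v) := by ring
    _ = ‖Complex.Gamma (s + v)‖ * (Real.Gamma (s.re + v) * ‖Complex.betaIntegral s v‖) := by
      rw [h1']; ring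
    _ ≤ ‖Complex.Gamma (s + v)‖ * (Real.Gamma (s.re + v) * ‖Complex.betaIntegral (s.re : ℂ) v‖) := by
      gcongr
    _ = _ := by rw [← h2']; ring

/-- On the line `Re s = 1/2` one has `1 - s = conj s`, so the reflection formula computes `|Γ(s)|²`
exactly. -/
lemma Complex.norm_Gamma_half_sq (y : ℝ) :
    ‖Complex.Gamma (1 / 2 + y * Complex.I)‖ ^ 2 = Real.pi / Real.cosh (Real.pi * y) := by
  have h := Complex.Gamma_mul_Gamma_one_sub (1 / 2 + y * Complex.I)
  have hc : 1 - (1 / 2 + y * Complex.I) = (starRingEnd ℂ) (1 / 2 + y * Complex.I) := by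
    simp [map_ofNat]; ring
  rw [hc, Complex.Gamma_conj, Complex.mul_conj, Complex.normSq_eq_norm_sq,
    show (Real.pi : ℂ) * (1 / 2 + y * Complex.I) =
      ((Real.pi * y : ℝ) : ℂ) * Complex.I + Real.pi / 2 by push_cast; ring,
    Complex.sin_add_pi_div_two, Complex.cos_mul_I, ← Complex.ofReal_cosh,
    ← Complex.ofReal_div] at h
  exact_mod_cast h

lemma Complex.norm_Gamma_half_le (y : ℝ) :
    ‖Complex.Gamma (1 / 2 + y * Complex.I)‖ ≤
      Real.sqrt (2 * Real.pi) * Real.exp (-(Real.pi / 2) * |y|) := by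
  refine le_of_sq_le_sq ?_ (by positivity)
  rw [Complex.norm_Gamma_half_sq, mul_pow, Real.sq_sqrt (by positivity), ← Real.exp_nat_mul,
    div_le_iff₀ (Real.cosh_pos _)]
  have h : Real.exp (Real.pi * |y|) ≤ 2 * Real.cosh (Real.pi * y) := by
    rw [← Real.cosh_abs (Real.pi * y), abs_mul, abs_of_pos Real.pi_pos, Real.cosh_eq]
    have := Real.exp_pos (-(Real.pi * |y|))
    linarith
  have h2 : Real.exp (((2 : ℕ) : ℝ) * (-(Real.pi / 2) * |y|)) * Real.exp (Real.pi * |y|) = 1 := by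
    rw [← Real.exp_add, ← Real.exp_zero]; congr 1; push_cast; ring
  have hE := Real.exp_pos (((2 : ℕ) : ℝ) * (-(Real.pi / 2) * |y|))
  calc Real.pi = Real.pi * (Real.exp (((2 : ℕ) : ℝ) * (-(Real.pi / 2) * |y|)) *
        Real.exp (Real.pi * |y|)) := by rw [h2, mul_one]
    _ ≤ Real.pi * (Real.exp (((2 : ℕ) : ℝ) * (-(Real.pi / 2) * |y|)) *
        (2 * Real.cosh (Real.pi * y))) := by gcongr
    _ = _ := by ring

lemma Complex.norm_Gamma_half_inv_le (y : ℝ) :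
    ‖Complex.Gamma (1 / 2 + y * Complex.I)‖⁻¹ ≤ Real.exp (Real.pi / 2 * |y|) := by
  refine le_of_sq_le_sq ?_ (by positivity)
  rw [inv_pow, Complex.norm_Gamma_half_sq, ← Real.exp_nat_mul, inv_div,
    div_le_iff₀ Real.pi_pos, ← Real.cosh_abs, abs_mul, abs_of_pos Real.pi_pos]
  have h1 : Real.cosh (Real.pi * |y|) ≤ Real.exp (Real.pi * |y|) := by
    rw [Real.cosh_eq]
    have : Real.exp (-(Real.pi * |y|)) ≤ Real.exp (Real.pi * |y|) := by
      apply Real.exp_le_exp.2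
      have : 0 ≤ Real.pi * |y| := by positivity
      linarith
    linarith
  have h2 : (1 : ℝ) ≤ Real.pi := by linarith [Real.pi_gt_three]
  have h3 : (((2 : ℕ) : ℝ) * (Real.pi / 2 * |y|)) = Real.pi * |y| := by push_cast; ring
  rw [h3]
  nlinarith [Real.exp_pos (Real.pi * |y|)]

/-- `f(x + iy) = O((1 + |y|)^k e^{θ|y|})` on the strip `a ≤ x ≤ b`, for some `k`. -/
def StripBound (a b θ : ℝ) (f : ℂ → ℂ) : Prop :=
  ∃ (C : ℝ) (k : ℕ), ∀ s : ℂ, a ≤ s.re → s.re ≤ b →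
    ‖f s‖ ≤ C * (1 + |s.im|) ^ k * Real.exp (θ * |s.im|)

/-! ### Calculus of growth bounds on vertical strips -/

namespace StripBound

variable {a b θ θ' : ℝ} {f g : ℂ → ℂ}

lemma exists_pos (hf : StripBound a b θ f) : ∃ (C : ℝ) (k : ℕ), 0 < C ∧ ∀ s : ℂ, a ≤ s.re →
    s.re ≤ b → ‖f s‖ ≤ C * (1 + |s.im|) ^ k * Real.exp (θ * |s.im|) := by
  obtain ⟨C, k, h⟩ := hf
  refine ⟨|C| + 1, k, by positivity, fun s h1 h2 => (h s h1 h2).trans ?_⟩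
  gcongr
  linarith [le_abs_self C]

lemma mul (hf : StripBound a b θ f) (hg : StripBound a b θ' g) :
    StripBound a b (θ + θ') (fun s => f s * g s) := by
  obtain ⟨C, k, hC, h⟩ := hf.exists_pos
  obtain ⟨D, l, hD, h'⟩ := hg.exists_pos
  refine ⟨C * D, k + l, fun s h1 h2 => ?_⟩
  rw [norm_mul]
  calc _ ≤ (C * (1 + |s.im|) ^ k * Real.exp (θ * |s.im|)) *
        (D * (1 + |s.im|) ^ l * Real.exp (θ' * |s.im|)) := by
        gcongr
        · exact h s h1 h2
        · exact h' s h1 h2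
    _ = _ := by rw [pow_add, add_mul θ, Real.exp_add]; ring

lemma sub (hf : StripBound a b θ f) (hg : StripBound a b θ g) :
    StripBound a b θ (fun s => f s - g s) := by
  obtain ⟨C, k, hC, h⟩ := hf.exists_pos
  obtain ⟨D, l, hD, h'⟩ := hg.exists_pos
  refine ⟨C + D, max k l, fun s h1 h2 => (norm_sub_le _ _).trans ?_⟩
  have hone : (1 : ℝ) ≤ 1 + |s.im| := by linarith [abs_nonneg s.im]
  rw [add_mul, add_mul]
  refine add_le_add ((h s h1 h2).trans ?_) ((h' s h1 h2).trans ?_)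
  · gcongr
    exact le_max_left _ _
  · gcongr
    exact le_max_right _ _

lemma of_norm_le {C : ℝ} (h : ∀ s : ℂ, a ≤ s.re → s.re ≤ b → ‖f s‖ ≤ C) : StripBound a b 0 f :=
  ⟨C, 0, fun s h1 h2 => by simpa using h s h1 h2⟩

lemma const (c : ℂ) : StripBound a b 0 (fun _ => c) := of_norm_le (C := ‖c‖) fun _ _ _ => le_rfl

lemma id : StripBound a b 0 (fun s => s) := by
  refine ⟨1 + |a| + |b|, 1, fun s h1 h2 => ?_⟩
  have h3 : |s.re| ≤ |a| + |b| := by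
    rcases abs_cases s.re with h | h <;> rcases abs_cases a with h' | h' <;>
      rcases abs_cases b with h'' | h'' <;> linarith
  have := Complex.norm_le_abs_re_add_abs_im s
  simp only [pow_one, zero_mul, Real.exp_zero, mul_one]
  nlinarith [abs_nonneg s.im, abs_nonneg a, abs_nonneg b]

lemma congr (hf : StripBound a b θ f) (h : ∀ s : ℂ, a ≤ s.re → s.re ≤ b → g s = f s) :
    StripBound a b θ g := by
  obtain ⟨C, k, hC⟩ := hf
  exact ⟨C, k, fun s h1 h2 => by rw [h s h1 h2]; exact hC s h1 h2⟩

/-- Shifting the imaginary part changes `e^{θ|y|}` by at most the constant factor `e^{|θ| |Im w|}`,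
whatever the sign of `θ`. -/
lemma comp_add (w : ℂ) (hf : StripBound (w.re + a) (w.re + b) θ f) :
    StripBound a b θ (fun s => f (w + s)) := by
  obtain ⟨C, k, hC, h⟩ := hf.exists_pos
  refine ⟨C * (1 + |w.im|) ^ k * Real.exp (|θ| * |w.im|), k, fun s h1 h2 => ?_⟩
  refine (h (w + s) (by simpa using h1) (by simpa using h2)).trans ?_
  have h3 : |(w + s).im| ≤ |w.im| + |s.im| := by simpa using abs_add_le w.im s.im
  have h4 : 1 + |(w + s).im| ≤ (1 + |w.im|) * (1 + |s.im|) := by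
    nlinarith [abs_nonneg w.im, abs_nonneg s.im]
  have h5 : θ * |(w + s).im| ≤ |θ| * |w.im| + θ * |s.im| := by
    have h6 : |(w + s).im| - |s.im| ≤ |w.im| := by linarith
    have h7 : -|w.im| ≤ |(w + s).im| - |s.im| := by
      have := abs_sub_abs_le_abs_sub s.im (-w.im)
      rw [abs_neg, sub_neg_eq_add, add_comm] at this
      simp only [Complex.add_im]
      linarith
    have h8 : θ * (|(w + s).im| - |s.im|) ≤ |θ| * |w.im| := by
      refine (le_abs_self _).trans ?_
      rw [abs_mul]
      exact mul_le_mul_of_nonneg_left (abs_le.2 ⟨h7, h6⟩) (abs_nonneg θ)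
    linarith
  calc _ ≤ C * ((1 + |w.im|) * (1 + |s.im|)) ^ k * Real.exp (|θ| * |w.im| + θ * |s.im|) := by
        gcongr
    _ = _ := by rw [mul_pow, Real.exp_add]; ring

lemma comp_neg (hf : StripBound (-b) (-a) θ f) : StripBound a b θ (fun s => f (-s)) := by
  obtain ⟨C, k, h⟩ := hf
  refine ⟨C, k, fun s h1 h2 => ?_⟩
  simpa using h (-s) (by simpa using h2) (by simpa using h1)

end StripBound

/-- Each application of `Γ(s + 1) = s Γ(s)` costs one power of `1 + |y|` and keeps the exponential
rate. -/
lemma Complex.norm_Gamma_half_add_nat (n : ℕ) :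
    ∃ (C : ℝ) (k : ℕ), ∀ y : ℝ, ‖Complex.Gamma (((n : ℝ) + 1 / 2 : ℝ) + y * Complex.I)‖ ≤
      C * (1 + |y|) ^ k * Real.exp (-(Real.pi / 2) * |y|) := by
  induction n with
  | zero =>
    refine ⟨Real.sqrt (2 * Real.pi), 0, fun y => ?_⟩
    have := Complex.norm_Gamma_half_le y
    norm_num at this ⊢
    exact this
  | succ n ih =>
    obtain ⟨C, k, h⟩ := ih
    refine ⟨(n + 1) * |C|, k + 1, fun y => ?_⟩
    set s : ℂ := ((n : ℝ) + 1 / 2 : ℝ) + y * Complex.I with hs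
    have hre : s.re = n + 1 / 2 := by simp [hs]
    have hne : s ≠ 0 := fun h0 => by
      rw [h0, Complex.zero_re] at hre
      have : (0 : ℝ) ≤ n := n.cast_nonneg
      linarith
    have hadd : (((n + 1 : ℕ) : ℝ) + 1 / 2 : ℝ) + y * Complex.I = s + 1 := by
      rw [hs]; push_cast; ring
    rw [hadd, Complex.Gamma_add_one s hne, norm_mul]
    have h1 : ‖s‖ ≤ (n + 1) * (1 + |y|) := by
      have := Complex.norm_le_abs_re_add_abs_im s
      have him : s.im = y := by simp [hs]
      rw [hre, him, abs_of_nonneg (by positivity)] at this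
      have : (0 : ℝ) ≤ n := n.cast_nonneg
      nlinarith [abs_nonneg y]
    have h2 := h y
    calc _ ≤ ((n + 1) * (1 + |y|)) * (|C| * (1 + |y|) ^ k * Real.exp (-(Real.pi / 2) * |y|)) := by
          gcongr
          refine h2.trans ?_
          gcongr
          exact le_abs_self C
      _ = _ := by ring

/-- Each point is compared with the one at the same height on a line `Re s = n + 1/2` to the right
of the strip. The real Gamma factors are bounded by compactness of `[a, b]`. -/
lemma StripBound.gamma {a b : ℝ} (ha : 0 < a) : StripBound a b (-(Real.pi / 2)) Complex.Gamma := by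
  obtain ⟨n, hn⟩ := exists_nat_gt b
  obtain ⟨C, k, h⟩ := Complex.norm_Gamma_half_add_nat n
  have hcont : ContinuousOn Real.Gamma (Set.Icc a b) :=
    Real.differentiableOn_Gamma_Ioi.continuousOn.mono fun x hx => lt_of_lt_of_le ha hx.1
  obtain ⟨M, hM⟩ := isCompact_Icc.exists_bound_of_continuousOn hcont
  refine ⟨M / Real.Gamma (n + 1 / 2) * |C|, k, fun s h1 h2 => ?_⟩
  have hs : 0 < s.re := ha.trans_le h1
  have hv : 0 < n + 1 / 2 - s.re := by linarith
  have hmain := Complex.norm_Gamma_mul_Gamma_le hs hv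
  have hp : 0 < Real.Gamma ((n : ℝ) + 1 / 2) := Real.Gamma_pos_of_pos (by positivity)
  rw [add_sub_cancel, ← le_div_iff₀ hp] at hmain
  have hsv : s + ((n + 1 / 2 - s.re : ℝ) : ℂ) = ((n : ℝ) + 1 / 2 : ℝ) + s.im * Complex.I := by
    apply Complex.ext <;> simp
  rw [hsv] at hmain
  have hMs := hM s.re ⟨h1, h2⟩
  rw [Real.norm_eq_abs, abs_of_pos (Real.Gamma_pos_of_pos hs)] at hMs
  have hE := h s.im
  have hM0 : 0 ≤ M := (Real.Gamma_pos_of_pos hs).le.trans hMs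
  calc _ ≤ _ := hmain
    _ ≤ (|C| * (1 + |s.im|) ^ k * Real.exp (-(Real.pi / 2) * |s.im|)) * M /
        Real.Gamma (n + 1 / 2) := by
      gcongr
      refine hE.trans ?_
      gcongr
      exact le_abs_self C
    _ = _ := by ring

/-- For `a > 1/2` the comparison is with the line `Re s = 1/2`, now to the left. Other strips are
brought there by `1/Γ(s) = s/Γ(s + 1)`, with `n` counting the shifts. -/
lemma StripBound.inv_gamma (a b : ℝ) : StripBound a b (Real.pi / 2) (fun s => (Complex.Gamma s)⁻¹) := by
  suffices H : ∀ (n : ℕ) (a b : ℝ), 1 / 2 < n + a →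
      StripBound a b (Real.pi / 2) (fun s => (Complex.Gamma s)⁻¹) by
    obtain ⟨n, hn⟩ := exists_nat_gt (1 / 2 - a)
    exact H n a b (by linarith)
  intro n
  induction n with
  | zero =>
    intro a b hab
    have ha : 1 / 2 < a := by simpa using hab
    have hcont : ContinuousOn (fun x => (Real.Gamma x)⁻¹) (Set.Icc a b) := by
      refine ContinuousOn.inv₀ (Real.differentiableOn_Gamma_Ioi.continuousOn.mono fun x hx => ?_)
        fun x hx => (Real.Gamma_pos_of_pos ?_).ne'
      · exact lt_of_lt_of_le (by linarith : (0 : ℝ) < a) hx.1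
      · exact lt_of_lt_of_le (by linarith : (0 : ℝ) < a) hx.1
    obtain ⟨M, hM⟩ := isCompact_Icc.exists_bound_of_continuousOn hcont
    refine ⟨Real.Gamma (1 / 2) * M, 0, fun s h1 h2 => ?_⟩
    have hhalf : 0 < (1 / 2 + s.im * Complex.I : ℂ).re := by simp
    have hv : 0 < s.re - 1 / 2 := by linarith
    have hs : 0 < s.re := by linarith
    have hmain := Complex.norm_Gamma_mul_Gamma_le hhalf hv
    have hre : (1 / 2 + s.im * Complex.I : ℂ).re = 1 / 2 := by simp
    have hsv : (1 / 2 + s.im * Complex.I : ℂ) + ((s.re - 1 / 2 : ℝ) : ℂ) = s := by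
      apply Complex.ext <;> simp
    rw [hre, hsv, add_sub_cancel] at hmain
    have hMs := hM s.re ⟨h1, h2⟩
    have hGp := Real.Gamma_pos_of_pos hs
    rw [Real.norm_eq_abs, abs_of_pos (inv_pos.2 hGp)] at hMs
    have hGs : 0 < ‖Complex.Gamma s‖ := norm_pos_iff.2 (Complex.Gamma_ne_zero_of_re_pos hs)
    have hGh : 0 < ‖Complex.Gamma (1 / 2 + s.im * Complex.I)‖ :=
      norm_pos_iff.2 (Complex.Gamma_ne_zero_of_re_pos hhalf)
    have hg2 : 0 < Real.Gamma (1 / 2) := Real.Gamma_pos_of_pos (by norm_num)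
    have hE := Complex.norm_Gamma_half_inv_le s.im
    rw [norm_inv, pow_zero, mul_one]
    have : ‖Complex.Gamma s‖⁻¹ ≤ Real.Gamma (1 / 2) * (Real.Gamma s.re)⁻¹ *
        ‖Complex.Gamma (1 / 2 + s.im * Complex.I)‖⁻¹ := by
      rw [← div_eq_mul_inv, ← div_eq_mul_inv, div_div, inv_eq_one_div, div_le_div_iff₀ hGs
        (by positivity)]
      linarith
    have hM0 : 0 ≤ M := (inv_pos.2 hGp).le.trans hMs
    refine this.trans ?_
    gcongr
  | succ n ih =>
    intro a b hab
    have h1 : StripBound a b (Real.pi / 2) (fun s => (Complex.Gamma (1 + s))⁻¹) :=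
      StripBound.comp_add (f := fun s => (Complex.Gamma s)⁻¹) 1
        (ih _ _ (by push_cast at hab; simp; linarith))
    have h2 := StripBound.id.mul h1
    rw [zero_add] at h2
    refine h2.congr fun s _ _ => ?_
    rw [add_comm 1 s]
    exact Complex.one_div_Gamma_eq_self_mul_one_div_Gamma_add_one s

/-! ### Shifting the contour of a Mellin-Barnes integral -/

lemma tendsto_one_add_pow_mul_exp_neg (k : ℕ) {c : ℝ} (hc : 0 < c) :
    Tendsto (fun y : ℝ => (1 + y) ^ k * Real.exp (-c * y)) atTop (𝓝 0) := by
  have h := Real.tendsto_pow_mul_exp_neg_atTop_nhds_zero k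
  have h1 : Tendsto (fun y : ℝ => c * (1 + y)) atTop atTop :=
    (tendsto_atTop_add_const_left _ _ tendsto_id).const_mul_atTop hc
  have h2 := (h.comp h1).const_mul (Real.exp c / c ^ k)
  rw [mul_zero] at h2
  refine h2.congr fun y => ?_
  have : Real.exp (-(c * (1 + y))) = Real.exp (-c) * Real.exp (-c * y) := by
    rw [← Real.exp_add]; congr 1; ring
  simp only [Function.comp]
  rw [this, mul_pow, Real.exp_neg c]
  field_simp

lemma integrable_one_add_abs_pow_mul_exp_neg (k : ℕ) {c : ℝ} (hc : 0 < c) :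
    MeasureTheory.Integrable (fun y : ℝ => (1 + |y|) ^ k * Real.exp (-c * |y|)) := by
  have hexp : MeasureTheory.IntegrableOn (fun y : ℝ => Real.exp (-(c / 2) * y)) (Set.Ioi 0) :=
    exp_neg_integrableOn_Ioi 0 (by positivity)
  have hlim := tendsto_one_add_pow_mul_exp_neg k (c := c / 2) (by positivity)
  have hcont : Continuous fun y : ℝ => (1 + |y|) ^ k * Real.exp (-c * |y|) := by fun_prop
  refine hcont.locallyIntegrable.integrable_of_isBigO_atTop_of_norm_isNegInvariant
    (g := fun y => Real.exp (-(c / 2) * y)) (Eventually.of_forall fun y => by simp) ?_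
    -- Half of the exponential rate absorbs the polynomial, the other half gives integrability.
    ⟨Set.Ioi 0, Ioi_mem_atTop 0, hexp⟩
  have h2 := (hlim.isBigO_one ℝ).mul (isBigO_refl (fun y : ℝ => Real.exp (-(c / 2) * y)) atTop)
  simp only [one_mul] at h2
  refine h2.congr' ?_ EventuallyEq.rfl
  filter_upwards [eventually_ge_atTop 0] with y hy
  rw [abs_of_nonneg hy, mul_assoc, ← Real.exp_add]
  congr 2
  ring

namespace StripBound

variable {a b θ : ℝ} {f : ℂ → ℂ}

lemma continuous_line (hf : DifferentiableOn ℂ f (Complex.re ⁻¹' Set.Icc a b)) {x : ℝ}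
    (hx : x ∈ Set.Icc a b) : Continuous fun t : ℝ => f (x + t * Complex.I) := by
  rw [← continuousOn_univ]
  refine hf.continuousOn.comp (by fun_prop) fun t _ => ?_
  simpa using hx

lemma integrable_line (hf : DifferentiableOn ℂ f (Complex.re ⁻¹' Set.Icc a b))
    (hb : StripBound a b θ f) (hθ : θ < 0) {x : ℝ} (hx : x ∈ Set.Icc a b) :
    MeasureTheory.Integrable fun t : ℝ => f (x + t * Complex.I) := by
  obtain ⟨C, k, h⟩ := hb
  have hint := (integrable_one_add_abs_pow_mul_exp_neg k (c := -θ) (by linarith)).const_mul C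
  refine hint.mono' (continuous_line hf hx).aestronglyMeasurable (Eventually.of_forall fun t => ?_)
  have := h (x + t * Complex.I) (by simpa using hx.1) (by simpa using hx.2)
  simpa [mul_assoc] using this

/-- A vertical contour may be moved across a strip on which the integrand is holomorphic and decays
exponentially. -/
lemma integral_line_eq (hab : a ≤ b) (hf : DifferentiableOn ℂ f (Complex.re ⁻¹' Set.Icc a b))
    (hb : StripBound a b θ f) (hθ : θ < 0) :
    ∫ t : ℝ, f (a + t * Complex.I) = ∫ t : ℝ, f (b + t * Complex.I) := by
  have ha' : a ∈ Set.Icc a b := ⟨le_rfl, hab⟩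
  have hb' : b ∈ Set.Icc a b := ⟨hab, le_rfl⟩
  have hlim : ∀ x ∈ Set.Icc a b, Tendsto (fun T : ℝ => ∫ t in (-T)..T, f (x + t * Complex.I))
      atTop (𝓝 (∫ t : ℝ, f (x + t * Complex.I))) := fun x hx =>
    MeasureTheory.intervalIntegral_tendsto_integral (hb.integrable_line hf hθ hx)
      tendsto_neg_atTop_atBot tendsto_id
  obtain ⟨C, k, hC, h⟩ := hb.exists_pos
  -- The horizontal sides of the rectangle, at heights `±T`, treated together through the sign `ε`.
  have hhor : ∀ ε : ℝ, |ε| = 1 → Tendsto (fun T : ℝ => ∫ x in a..b, f (x + (ε * T : ℝ) * Complex.I))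
      atTop (𝓝 0) := by
    intro ε hε
    have hT := ((tendsto_one_add_pow_mul_exp_neg k (c := -θ) (by linarith)).const_mul C).mul_const
      |b - a|
    rw [mul_zero, zero_mul] at hT
    refine squeeze_zero_norm' ?_ hT
    filter_upwards [eventually_ge_atTop 0] with T hT0
    refine intervalIntegral.norm_integral_le_of_norm_le_const fun x hx => ?_
    rw [Set.uIoc_of_le hab] at hx
    have := h (x + (ε * T : ℝ) * Complex.I) (by simpa using hx.1.le) (by simpa using hx.2)
    simp only [Complex.add_im, Complex.ofReal_im, Complex.mul_im, Complex.ofReal_re, Complex.I_im,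
      Complex.I_re, mul_one, mul_zero, zero_add, add_zero, abs_mul, hε, one_mul,
      abs_of_nonneg hT0, neg_neg] at this ⊢
    linarith
  have hrect : ∀ T : ℝ, (∫ x in a..b, f (x + (-1 * T : ℝ) * Complex.I)) -
      (∫ x in a..b, f (x + (1 * T : ℝ) * Complex.I)) +
      Complex.I * (∫ t in (-T)..T, f (b + t * Complex.I)) -
      Complex.I * (∫ t in (-T)..T, f (a + t * Complex.I)) = 0 := by
    intro T
    have := Complex.integral_boundary_rect_eq_zero_of_differentiableOn f
      (a + (-T : ℝ) * Complex.I) (b + (T : ℝ) * Complex.I) (hf.mono ?_)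
    · simpa using this
    · intro s hs
      rw [Complex.mem_reProdIm] at hs
      have := hs.1
      simp only [Complex.add_re, Complex.ofReal_re, Complex.mul_re, Complex.I_re, mul_zero,
        Complex.ofReal_im, Complex.I_im, mul_one, sub_self, add_zero, Set.uIcc_of_le hab] at this
      exact this
  have htot := (((hhor (-1) (by simp)).sub (hhor 1 (by simp))).add
    ((hlim b hb').const_mul Complex.I)).sub ((hlim a ha').const_mul Complex.I)
  simp only [hrect] at htot
  have := tendsto_nhds_unique tendsto_const_nhds htot
  rw [sub_zero, zero_add, ← mul_sub] at this
  have h0 := (mul_eq_zero.1 this.symm).resolve_left Complex.I_ne_zero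
  exact (sub_eq_zero.1 h0).symm

/-- On a closed strip it suffices to bound a continuous function away from the real axis. -/
lemma of_one_le_abs_im (hf : ContinuousOn f (Complex.re ⁻¹' Set.Icc a b))
    (h : ∃ (C : ℝ) (k : ℕ), ∀ s : ℂ, a ≤ s.re → s.re ≤ b → 1 ≤ |s.im| →
      ‖f s‖ ≤ C * (1 + |s.im|) ^ k * Real.exp (θ * |s.im|)) : StripBound a b θ f := by
  obtain ⟨C, k, h⟩ := h
  have hK : IsCompact (Set.Icc a b ×ℂ Set.Icc (-1 : ℝ) 1) := isCompact_Icc.reProdIm isCompact_Icc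
  obtain ⟨M, hM⟩ := hK.exists_bound_of_continuousOn (hf.mono fun s hs => hs.1)
  refine ⟨|C| + |M| * Real.exp |θ|, k, fun s h1 h2 => ?_⟩
  have hone : (1 : ℝ) ≤ (1 + |s.im|) ^ k := one_le_pow₀ (by linarith [abs_nonneg s.im])
  rw [add_mul, add_mul]
  rcases le_or_gt 1 |s.im| with h3 | h3
  · refine (h s h1 h2 h3).trans ?_
    have : C * (1 + |s.im|) ^ k * Real.exp (θ * |s.im|) ≤
        |C| * (1 + |s.im|) ^ k * Real.exp (θ * |s.im|) := by
      gcongr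
      exact le_abs_self C
    have h4 : 0 ≤ |M| * Real.exp |θ| * (1 + |s.im|) ^ k * Real.exp (θ * |s.im|) := by positivity
    linarith
  · have h4 := hM s ⟨⟨h1, h2⟩, abs_le.1 h3.le⟩
    -- For `|y| ≤ 1` the weight `e^{θ|y|}` is at least `e^{-|θ|}`; hence the constant `e^{|θ|}` in
    -- the witness.
    have h5 : 1 ≤ Real.exp |θ| * Real.exp (θ * |s.im|) := by
      rw [← Real.exp_add, Real.one_le_exp_iff]
      have h7 : abs (θ * abs s.im) ≤ |θ| * 1 := by
        rw [abs_mul, abs_abs]; gcongr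
      linarith [neg_abs_le (θ * |s.im|)]
    have h6 : |M| * (1 * 1) ≤ |M| * ((1 + |s.im|) ^ k * (Real.exp |θ| * Real.exp (θ * |s.im|))) := by
      gcongr
    have h7 : 0 ≤ |C| * (1 + |s.im|) ^ k * Real.exp (θ * |s.im|) := by positivity
    have h8 := le_abs_self M
    linarith

end StripBound

/-! ### Small-argument behaviour of `G^{2,1}_{3,2}` -/

/-- Mellin inversion for `e^{-x}`, whose transform is `Γ`. This evaluates the subtracted pole term
in closed form. -/
lemma integral_gamma_line {σ z : ℝ} (hσ : 0 < σ) (hz : 0 < z) :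
    (1 / (2 * (Real.pi : ℂ))) * ∫ t : ℝ, Complex.Gamma (σ + t * Complex.I) *
      (z : ℂ) ^ (-((σ : ℂ) + t * Complex.I)) = Real.exp (-z) := by
  have hmellin : ∀ s : ℂ, 0 < s.re →
      mellin (fun x : ℝ => ((Real.exp (-x) : ℝ) : ℂ)) s = Complex.Gamma s := fun s hs => by
    rw [Complex.Gamma_eq_integral hs, Complex.GammaIntegral_eq_mellin]
  have hre : ∀ t : ℝ, 0 < ((σ : ℂ) + t * Complex.I).re := fun t => by simpa using hσ
  have hdiff : DifferentiableOn ℂ Complex.Gamma (Complex.re ⁻¹' Set.Icc σ σ) := fun s hs =>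
    (Complex.differentiableAt_Gamma s fun m hm => by
      have h1 : σ ≤ s.re := hs.1
      rw [hm] at h1
      simp at h1
      linarith [(Nat.cast_nonneg m : (0 : ℝ) ≤ m)]).differentiableWithinAt
  have hint := (StripBound.gamma hσ (b := σ)).integrable_line hdiff
    (by linarith [Real.pi_pos]) (x := σ) ⟨le_rfl, le_rfl⟩
  have := mellinInv_mellin_eq σ (fun x : ℝ => ((Real.exp (-x) : ℝ) : ℂ)) hz ?_ ?_ (by fun_prop)
  · rw [← this, mellinInv, Complex.real_smul]
    push_cast
    congr 1
    refine MeasureTheory.integral_congr_ae (Eventually.of_forall fun t => ?_)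
    simp only [smul_eq_mul]
    rw [← hmellin _ (hre t), mul_comm]
    push_cast
    rfl
  · have h := Complex.GammaIntegral_convergent (s := σ) (by simpa)
    refine h.congr_fun (fun x _ => ?_) measurableSet_Ioi
    simp [mul_comm]
  · refine hint.congr (Eventually.of_forall fun t => ?_)
    exact (hmellin _ (hre t)).symm

/-- The kernel of `G^{2,1}_{3,2}( · | 0 ; a₃, a₄ / u, v ; -)` without the factor `Γ(u + s)`. -/
def meijerCofactor (a₃ a₄ : ℂ) (v : ℝ) (s : ℂ) : ℂ :=
  Complex.Gamma (v + s) * Complex.Gamma (1 - s) *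
    ((Complex.Gamma (a₃ + s))⁻¹ * (Complex.Gamma (a₄ + s))⁻¹)

lemma Complex.differentiableAt_Gamma_of_re_pos {s : ℂ} (hs : 0 < s.re) :
    DifferentiableAt ℂ Complex.Gamma s :=
  Complex.differentiableAt_Gamma s fun m hm => by
    rw [hm] at hs
    simp at hs
    linarith [(Nat.cast_nonneg m : (0 : ℝ) ≤ m)]

lemma differentiableAt_meijerCofactor (a₃ a₄ : ℂ) {v : ℝ} {s : ℂ} (h1 : -v < s.re) (h2 : s.re < 1) :
    DifferentiableAt ℂ (meijerCofactor a₃ a₄ v) s := by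
  have hG1 : DifferentiableAt ℂ (fun s => Complex.Gamma (v + s)) s :=
    (Complex.differentiableAt_Gamma_of_re_pos (s := v + s) (by simp; linarith)).comp s
      (by fun_prop : DifferentiableAt ℂ (fun s => (v : ℂ) + s) s)
  have hG2 : DifferentiableAt ℂ (fun s => Complex.Gamma (1 - s)) s :=
    (Complex.differentiableAt_Gamma_of_re_pos (s := 1 - s) (by simp; linarith)).comp s
      (by fun_prop : DifferentiableAt ℂ (fun s => (1 : ℂ) - s) s)
  have hG3 : ∀ a : ℂ, DifferentiableAt ℂ (fun s => (Complex.Gamma (a + s))⁻¹) s := fun a =>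
    (Complex.differentiable_one_div_Gamma (a + s)).comp s
      (by fun_prop : DifferentiableAt ℂ (fun s => a + s) s)
  exact (hG1.mul hG2).mul ((hG3 a₃).mul (hG3 a₄))

/-- The exponential rates of two Gammas and two reciprocal Gammas cancel, so the growth is
polynomial. -/
lemma stripBound_meijerCofactor (a₃ a₄ : ℂ) {v a b : ℝ} (ha : -v < a) (hb : b < 1) :
    StripBound a b 0 (meijerCofactor a₃ a₄ v) := by
  have h1 : StripBound a b (-(Real.pi / 2)) fun s => Complex.Gamma (v + s) :=
    StripBound.comp_add (v : ℂ) (StripBound.gamma (by simp; linarith))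
  have h2 : StripBound a b (-(Real.pi / 2)) fun s => Complex.Gamma (1 - s) := by
    have : StripBound (-b) (-a) (-(Real.pi / 2)) fun s => Complex.Gamma (1 + s) :=
      StripBound.comp_add 1 (StripBound.gamma (by simp; linarith))
    simpa [sub_eq_add_neg] using this.comp_neg
  have h3 : ∀ w : ℂ, StripBound a b (Real.pi / 2) fun s => (Complex.Gamma (w + s))⁻¹ := fun w =>
    StripBound.comp_add (f := fun s => (Complex.Gamma s)⁻¹) w (StripBound.inv_gamma _ _)
  have h := (h1.mul h2).mul ((h3 a₃).mul (h3 a₄))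
  rwa [show -(Real.pi / 2) + -(Real.pi / 2) + (Real.pi / 2 + Real.pi / 2) = 0 by ring] at h

/-- The Mellin-Barnes integral of `G^{2,1}_{3,2}( · | 0 ; a₃, a₄ / u, v ; -)` along `Re s = c`. -/
def meijerLine (a₃ a₄ : ℂ) (u v c z : ℝ) : ℂ :=
  (1 / (2 * (Real.pi : ℂ))) * ∫ t : ℝ, Complex.Gamma (u + ((c : ℂ) + t * Complex.I)) *
    meijerCofactor a₃ a₄ v ((c : ℂ) + t * Complex.I) * (z : ℂ) ^ (-((c : ℂ) + t * Complex.I))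

lemma StripBound.cpow_neg {a b z : ℝ} (hz : 0 < z) :
    StripBound a b 0 (fun s => (z : ℂ) ^ (-s)) := by
  have hcont : Continuous fun x : ℝ => z ^ (-x) :=
    Real.continuous_const_rpow hz.ne' |>.comp continuous_neg
  obtain ⟨M, hM⟩ := (isCompact_Icc (a := a) (b := b)).exists_bound_of_continuousOn hcont.continuousOn
  refine StripBound.of_norm_le (C := M) fun s h1 h2 => ?_
  rw [Complex.norm_cpow_eq_rpow_re_of_pos hz]
  exact (le_abs_self _).trans (hM s.re ⟨h1, h2⟩)

/-- The kernel minus the simple-pole term `R Γ(u + s)` extends holomorphically across `s = -u`. -/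
lemma exists_regular_part (a₃ a₄ : ℂ) {u v d c : ℝ} (hv : -v < d) (hu : -u - 1 < d) (hd : d < -u)
    (hc : -u < c) (hc1 : c < 1) :
    ∃ D : ℂ → ℂ, DifferentiableOn ℂ D (Complex.re ⁻¹' Set.Icc d c) ∧
      StripBound d c (-(Real.pi / 2)) D ∧
      ∀ s : ℂ, s.re ≠ -u → D s =
        (meijerCofactor a₃ a₄ v s - meijerCofactor a₃ a₄ v (-u)) * Complex.Gamma (u + s) := by
  set H := meijerCofactor a₃ a₄ v with hH
  -- The next poles to the left of `-u`: the first one of `Γ(v + s)` and the second one of `Γ(u +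
  -- s)`.
  set e := max (-v) (-u - 1) with he
  have hed : e < d := max_lt hv hu
  have hUo : IsOpen (Complex.re ⁻¹' Set.Ioo e 1) := isOpen_Ioo.preimage Complex.continuous_re
  have hHd : DifferentiableOn ℂ H (Complex.re ⁻¹' Set.Ioo e 1) := fun s hs =>
    (differentiableAt_meijerCofactor a₃ a₄ ((le_max_left _ _).trans_lt hs.1)
      hs.2).differentiableWithinAt
  have hmem : (-u : ℂ) ∈ Complex.re ⁻¹' Set.Ioo e 1 := by
    simp only [Set.mem_preimage, Complex.neg_re, Complex.ofReal_re]
    exact ⟨by linarith, by linarith⟩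
  have hsub : Complex.re ⁻¹' Set.Icc d c ⊆ Complex.re ⁻¹' Set.Ioo e 1 := fun s hs =>
    ⟨hed.trans_le hs.1, lt_of_le_of_lt hs.2 hc1⟩
  have hslope : DifferentiableOn ℂ (dslope H (-u)) (Complex.re ⁻¹' Set.Ioo e 1) :=
    (Complex.differentiableOn_dslope (hUo.mem_nhds hmem)).2 hHd
  have hgam : DifferentiableOn ℂ (fun s => Complex.Gamma (u + 1 + s)) (Complex.re ⁻¹' Set.Ioo e 1) := by
    intro s hs
    have h1 : -u - 1 < s.re := (le_max_right _ _).trans_lt hs.1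
    exact ((Complex.differentiableAt_Gamma_of_re_pos (s := u + 1 + s) (by simp; linarith)).comp s
      (by fun_prop : DifferentiableAt ℂ (fun s => (u : ℂ) + 1 + s) s)).differentiableWithinAt
  -- Since `Γ(u + s) = Γ(u + 1 + s) / (u + s)`, the pole is absorbed into the difference quotient of
  -- `H` at `-u`.
  have hD : ∀ s : ℂ, s ≠ -u → dslope H (-u) s * Complex.Gamma (u + 1 + s) =
      (H s - H (-u)) * Complex.Gamma (u + s) := by
    intro s hs
    have hne : (u : ℂ) + s ≠ 0 := fun h0 => hs (by rw [eq_neg_iff_add_eq_zero, add_comm]; exact h0)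
    rw [dslope_of_ne _ hs, slope_def_field, show (u : ℂ) + 1 + s = (u + s) + 1 by ring,
      Complex.Gamma_add_one _ hne, sub_neg_eq_add, add_comm s]
    field_simp
  have hdiff : DifferentiableOn ℂ (fun s => dslope H (-u) s * Complex.Gamma (u + 1 + s))
      (Complex.re ⁻¹' Set.Icc d c) := (hslope.mul hgam).mono hsub
  refine ⟨fun s => dslope H (-u) s * Complex.Gamma (u + 1 + s), hdiff, ?_, fun s hs => hD s ?_⟩
  · refine StripBound.of_one_le_abs_im hdiff.continuousOn ?_
    have hb1 : StripBound d c 0 (fun s => H s - H (-u)) :=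
      (stripBound_meijerCofactor a₃ a₄ hv hc1).sub (StripBound.const _)
    have hb2 : StripBound d c (-(Real.pi / 2)) (fun s => Complex.Gamma (u + 1 + s)) := by
      have := StripBound.comp_add (a := d) (b := c) ((u : ℂ) + 1)
        (StripBound.gamma (a := ((u : ℂ) + 1).re + d) (b := ((u : ℂ) + 1).re + c)
          (by simp; linarith))
      exact this
    obtain ⟨C, k, h⟩ := hb1.mul hb2
    rw [zero_add] at h
    refine ⟨C, k, fun s h1 h2 h3 => ?_⟩
    have him : (1 : ℝ) ≤ ‖(u : ℂ) + s‖ := by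
      refine h3.trans ?_
      have := Complex.abs_im_le_norm ((u : ℂ) + s)
      simpa using this
    have hne : s ≠ -u := fun h0 => by
      rw [h0] at h3; norm_num at h3
    have hne0 : (u : ℂ) + s ≠ 0 := fun h0 => by rw [h0, norm_zero] at him; linarith
    refine le_trans ?_ (h s h1 h2)
    simp only
    rw [hD s hne, norm_mul, norm_mul, show (u : ℂ) + 1 + s = (u + s) + 1 by ring,
      Complex.Gamma_add_one _ hne0, norm_mul]
    gcongr
    exact le_mul_of_one_le_left (norm_nonneg _) him
  · rintro rfl
    simp at hs

/-- `G(z) z^{-u}` tends to the residue coefficient as `z → 0+`. -/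
lemma tendsto_meijerLine_div (a₃ a₄ : ℂ) {u v c : ℝ} (huv : u < v) (hc : -u < c) (hc1 : c < 1) :
    Tendsto (fun z : ℝ => meijerLine a₃ a₄ u v c z / ((z ^ u : ℝ) : ℂ)) (𝓝[>] 0)
      (𝓝 (meijerCofactor a₃ a₄ v (-u))) := by
  set R := meijerCofactor a₃ a₄ v (-u) with hR
  obtain ⟨d, hd1, hd2⟩ := exists_between (show max (-v) (-u - 1) < -u by
    rw [max_lt_iff]; constructor <;> linarith)
  rw [max_lt_iff] at hd1
  obtain ⟨D, hDd, hDb, hDe⟩ := exists_regular_part a₃ a₄ hd1.1 hd1.2 hd2 hc hc1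
  have hpi := Real.pi_pos
  have hdc : d ≤ c := by linarith
  set M := ∫ t : ℝ, ‖D (d + t * Complex.I)‖ with hM
  have hGd : DifferentiableOn ℂ (fun s => Complex.Gamma (u + s)) (Complex.re ⁻¹' Set.Icc c c) := by
    intro s hs
    exact ((Complex.differentiableAt_Gamma_of_re_pos (s := u + s)
      (by have := hs.1; simp; linarith)).comp s
      (by fun_prop : DifferentiableAt ℂ (fun s => (u : ℂ) + s) s)).differentiableWithinAt
  have hGb : StripBound c c (-(Real.pi / 2)) (fun s => Complex.Gamma (u + s)) :=
    StripBound.comp_add (u : ℂ) (StripBound.gamma (by simp; linarith))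
  have hexp : ∀ z : ℝ, 0 < z → Differentiable ℂ (fun s : ℂ => (z : ℂ) ^ (-s)) := fun z hz =>
    differentiable_neg.const_cpow (Or.inl (by exact_mod_cast hz.ne'))
  -- Kernel = `R Γ(u + s) + D(s)` on `Re s = c`; the first term is integrated exactly, the second is
  -- moved to `Re s = d`.
  have key : ∀ z : ℝ, 0 < z → meijerLine a₃ a₄ u v c z = R * ((z ^ u * Real.exp (-z) : ℝ) : ℂ) +
      (1 / (2 * (Real.pi : ℂ))) * ∫ t : ℝ, D (d + t * Complex.I) *
        (z : ℂ) ^ (-((d : ℂ) + t * Complex.I)) := by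
    intro z hz
    have hz0 : (z : ℂ) ≠ 0 := by exact_mod_cast hz.ne'
    have hsh := StripBound.integral_line_eq (f := fun s => D s * (z : ℂ) ^ (-s)) hdc
      (hDd.mul (hexp z hz).differentiableOn) (hDb.mul (StripBound.cpow_neg hz)) (by linarith)
    have hi1 := StripBound.integrable_line (f := fun s => D s * (z : ℂ) ^ (-s))
      (hDd.mul (hexp z hz).differentiableOn) (hDb.mul (StripBound.cpow_neg hz)) (by linarith)
      (x := c) ⟨hdc, le_rfl⟩
    have hi2 := StripBound.integrable_line (f := fun s => Complex.Gamma (u + s) * (z : ℂ) ^ (-s))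
      (hGd.mul (hexp z hz).differentiableOn) (hGb.mul (StripBound.cpow_neg hz)) (by linarith)
      (x := c) ⟨le_rfl, le_rfl⟩
    have hgl := integral_gamma_line (σ := u + c) (z := z) (by linarith) hz
    have hgl2 : (1 / (2 * (Real.pi : ℂ))) * ∫ t : ℝ, Complex.Gamma (u + ((c : ℂ) + t * Complex.I)) *
        (z : ℂ) ^ (-((c : ℂ) + t * Complex.I)) = ((z ^ u * Real.exp (-z) : ℝ) : ℂ) := by
      rw [Complex.ofReal_mul, ← hgl, mul_left_comm]
      congr 1
      rw [← MeasureTheory.integral_const_mul]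
      refine MeasureTheory.integral_congr_ae (Eventually.of_forall fun t => ?_)
      simp only
      rw [Complex.ofReal_cpow hz.le, mul_left_comm, ← Complex.cpow_add _ _ hz0]
      congr 2
      · push_cast; ring
      · push_cast; ring
    have hsum := MeasureTheory.integral_add (hi2.const_mul R) hi1
    rw [MeasureTheory.integral_const_mul, ← hsh] at hsum
    rw [← hgl2, mul_left_comm, ← mul_add]
    refine Eq.trans ?_ (congrArg (fun w => 1 / (2 * (Real.pi : ℂ)) * w) hsum)
    unfold meijerLine
    congr 1
    refine MeasureTheory.integral_congr_ae (Eventually.of_forall fun t => ?_)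
    simp only
    rw [hDe _ (by simp; linarith)]
    ring
  -- On `Re s = d` the power has modulus `z^{-d}`; after division by `z^u` the exponent `-d - u` is
  -- positive.
  have hbound : ∀ z : ℝ, 0 < z → ‖(1 / (2 * (Real.pi : ℂ))) * (∫ t : ℝ, D (d + t * Complex.I) *
        (z : ℂ) ^ (-((d : ℂ) + t * Complex.I))) / ((z ^ u : ℝ) : ℂ)‖ ≤
      1 / (2 * Real.pi) * M * z ^ (-d - u) := by
    intro z hz
    have h1 : ‖∫ t : ℝ, D (d + t * Complex.I) * (z : ℂ) ^ (-((d : ℂ) + t * Complex.I))‖ ≤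
        z ^ (-d) * M := by
      rw [hM, ← MeasureTheory.integral_const_mul]
      refine (MeasureTheory.norm_integral_le_integral_norm _).trans_eq ?_
      refine MeasureTheory.integral_congr_ae (Eventually.of_forall fun t => ?_)
      simp only [norm_mul, Complex.norm_cpow_eq_rpow_re_of_pos hz]
      simp [mul_comm]
    rw [norm_div, norm_mul, Complex.norm_real, Real.norm_eq_abs,
      abs_of_pos (Real.rpow_pos_of_pos hz u), Real.rpow_sub hz, mul_div_assoc', mul_assoc]
    have h2 : ‖(1 / (2 * (Real.pi : ℂ)))‖ = 1 / (2 * Real.pi) := by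
      simp [abs_of_pos hpi]
    rw [h2, mul_comm M]
    gcongr
  have hz1 : Tendsto (fun z : ℝ => R * ((Real.exp (-z) : ℝ) : ℂ)) (𝓝[>] 0) (𝓝 R) := by
    have : Tendsto (fun z : ℝ => R * ((Real.exp (-z) : ℝ) : ℂ)) (𝓝 0)
        (𝓝 (R * ((Real.exp (-0) : ℝ) : ℂ))) := by
      apply Continuous.tendsto
      fun_prop
    rw [neg_zero, Real.exp_zero, Complex.ofReal_one, mul_one] at this
    exact this.mono_left nhdsWithin_le_nhds
  have hz2 : Tendsto (fun z : ℝ => 1 / (2 * Real.pi) * M * z ^ (-d - u)) (𝓝[>] 0) (𝓝 0) := by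
    have h1 : Tendsto (fun z : ℝ => z ^ (-d - u)) (𝓝 0) (𝓝 (0 ^ (-d - u))) :=
      (Real.continuousAt_rpow_const _ _ (Or.inr (by linarith))).tendsto
    rw [Real.zero_rpow (by linarith)] at h1
    simpa using (h1.mono_left nhdsWithin_le_nhds).const_mul (1 / (2 * Real.pi) * M)
  have hz3 : Tendsto (fun z : ℝ => (1 / (2 * (Real.pi : ℂ))) * (∫ t : ℝ, D (d + t * Complex.I) *
        (z : ℂ) ^ (-((d : ℂ) + t * Complex.I))) / ((z ^ u : ℝ) : ℂ)) (𝓝[>] 0) (𝓝 0) :=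
    squeeze_zero_norm' (by filter_upwards [self_mem_nhdsWithin] with z hz using hbound z hz) hz2
  have := hz1.add hz3
  rw [add_zero] at this
  refine this.congr' ?_
  filter_upwards [self_mem_nhdsWithin] with z hz
  have hz0 : ((z ^ u : ℝ) : ℂ) ≠ 0 := by exact_mod_cast (Real.rpow_pos_of_pos hz u).ne'
  rw [key z hz, add_div, Complex.ofReal_mul]
  congr 1
  field_simp

lemma stronglyMeasurable_meijerLine (a₃ a₄ : ℂ) {u v c : ℝ} (hu : -u < c) (hv : -v < c)
    (hc1 : c < 1) : MeasureTheory.StronglyMeasurable (meijerLine a₃ a₄ u v c) := by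
  unfold meijerLine
  refine MeasureTheory.StronglyMeasurable.const_mul ?_ _
  have hline : Continuous fun t : ℝ => Complex.Gamma (u + ((c : ℂ) + t * Complex.I)) *
      meijerCofactor a₃ a₄ v ((c : ℂ) + t * Complex.I) := by
    refine continuous_iff_continuousAt.2 fun t => ?_
    have h1 : ContinuousAt (fun s : ℂ => Complex.Gamma (u + s)) (c + t * Complex.I) :=
      ((Complex.differentiableAt_Gamma_of_re_pos (s := u + (c + t * Complex.I))
        (by simp; linarith)).comp _
        (by fun_prop : DifferentiableAt ℂ (fun s => (u : ℂ) + s) _)).continuousAt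
    have h2 := (differentiableAt_meijerCofactor a₃ a₄ (v := v) (s := c + t * Complex.I)
      (by simpa) (by simpa)).continuousAt
    exact (h1.mul h2).comp (f := fun t : ℝ => (c : ℂ) + t * Complex.I) (by fun_prop)
  refine MeasureTheory.StronglyMeasurable.integral_prod_right
    (f := fun z t : ℝ => Complex.Gamma (u + ((c : ℂ) + t * Complex.I)) *
      meijerCofactor a₃ a₄ v ((c : ℂ) + t * Complex.I) * (z : ℂ) ^ (-((c : ℂ) + t * Complex.I))) ?_
  refine Measurable.stronglyMeasurable ?_
  refine (hline.measurable.comp measurable_snd).mul (Measurable.pow ?_ ?_)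
  · exact Complex.measurable_ofReal.comp measurable_fst
  · fun_prop

/-- For `-1 < u, v` the function `G^{2,1}_{3,2}( · | 0 ; a₃, a₄ / u, v ; -)` is `meijerLine` along
a separating abscissa. -/
lemma exists_meijerG_eq_meijerLine (a₃ a₄ : ℂ) {u v : ℝ} (hu : -1 < u) (hv : -1 < v) :
    ∃ c : ℝ, -u < c ∧ -v < c ∧ c < 1 ∧ ∀ z : ℝ,
      meijerG [0] [a₃, a₄] [(u : ℂ), (v : ℂ)] [] z = meijerLine a₃ a₄ u v c z ∧
      meijerG [0] [a₃, a₄] [(v : ℂ), (u : ℂ)] [] z = meijerLine a₃ a₄ u v c z := by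
  have hsep : ∀ c, MeijerSeparates [0] [(u : ℂ), (v : ℂ)] c ↔ (-u < c ∧ -v < c) ∧ c < 1 := by
    intro c; simp [MeijerSeparates]
  have hsymm : MeijerSeparates [0] [(v : ℂ), (u : ℂ)] = MeijerSeparates [0] [(u : ℂ), (v : ℂ)] := by
    ext c; simp [MeijerSeparates, and_comm]
  have hex : ∃ c, MeijerSeparates [0] [(u : ℂ), (v : ℂ)] c := by
    obtain ⟨c, h1, h2⟩ := exists_between (show max (-u) (-v) < 1 by
      rw [max_lt_iff]; constructor <;> linarith)
    exact ⟨c, (hsep c).2 ⟨max_lt_iff.1 h1, h2⟩⟩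
  have hspec := (hsep _).1 (Classical.epsilon_spec hex)
  -- The abscissa is chosen from the separation predicate, which is symmetric in `u` and `v`. Both
  -- orders are needed, since either of `a₅`, `a₆` may be the smaller.
  have habs : meijerAbscissa [0] [(v : ℂ), (u : ℂ)] = meijerAbscissa [0] [(u : ℂ), (v : ℂ)] := by
    unfold meijerAbscissa; rw [hsymm]
  refine ⟨meijerAbscissa [0] [(u : ℂ), (v : ℂ)], hspec.1.1, hspec.1.2, hspec.2, fun z => ⟨?_, ?_⟩⟩
  · unfold meijerG meijerLine meijerKernel meijerCofactor
    congr 1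
    refine MeasureTheory.integral_congr_ae (Eventually.of_forall fun t => ?_)
    simp [div_eq_mul_inv]
    ring_nf
    simp
  · unfold meijerG meijerLine meijerKernel meijerCofactor
    rw [habs]
    congr 1
    refine MeasureTheory.integral_congr_ae (Eventually.of_forall fun t => ?_)
    simp [div_eq_mul_inv]
    ring_nf
    simp

/-! ### Integrals of powers of the sine -/

lemma image_half_one_sub_cos :
    (fun t : ℝ => (1 - Real.cos t) / 2) '' Set.Ioo 0 Real.pi = Set.Ioo 0 1 := by
  ext y
  constructor
  · rintro ⟨t, ht, rfl⟩
    have h1 : Real.cos t < 1 := by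
      have := Real.cos_lt_cos_of_nonneg_of_le_pi le_rfl ht.2.le ht.1
      rwa [Real.cos_zero] at this
    have h2 : -1 < Real.cos t := by
      have := Real.cos_lt_cos_of_nonneg_of_le_pi ht.1.le le_rfl ht.2
      rwa [Real.cos_pi] at this
    exact ⟨by simp only; linarith, by simp only; linarith⟩
  · rintro ⟨h0, h1⟩
    refine ⟨Real.arccos (1 - 2 * y), ⟨Real.arccos_pos.2 (by linarith), ?_⟩, ?_⟩
    · refine lt_of_le_of_ne (Real.arccos_le_pi _) fun h => ?_
      have := Real.arccos_eq_pi.1 h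
      linarith
    · simp only
      rw [Real.cos_arccos (by linarith) (by linarith)]
      ring

/-- The substitution `x = (1 - cos t) / 2` turns `x (1 - x)` into `sin² t / 4`. -/
lemma four_rpow_mul_betaIntegral_eq (w : ℝ) :
    (((4 : ℝ) ^ w : ℝ) : ℂ) * Complex.betaIntegral (w + 1 / 2) (w + 1 / 2) =
      ((∫ t in (0 : ℝ)..Real.pi, Real.sin t ^ (2 * w) : ℝ) : ℂ) := by
  have hderiv : ∀ t ∈ Set.Ioo 0 Real.pi, HasDerivWithinAt (fun t : ℝ => (1 - Real.cos t) / 2)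
      (Real.sin t / 2) (Set.Ioo 0 Real.pi) t := fun t _ => by
    have := ((Real.hasDerivAt_cos t).const_sub 1).div_const 2
    rw [neg_neg] at this
    exact this.hasDerivWithinAt
  have hinj : Set.InjOn (fun t : ℝ => (1 - Real.cos t) / 2) (Set.Ioo 0 Real.pi) := by
    intro x hx y hy hxy
    refine Real.injOn_cos ⟨hx.1.le, hx.2.le⟩ ⟨hy.1.le, hy.2.le⟩ ?_
    simp only at hxy
    linarith
  have hsubst := MeasureTheory.integral_image_eq_integral_abs_deriv_smul measurableSet_Ioo hderiv
    hinj (fun x : ℝ => x ^ (w - 1 / 2) * (1 - x) ^ (w - 1 / 2))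
  rw [image_half_one_sub_cos] at hsubst
  have hbeta : Complex.betaIntegral (w + 1 / 2) (w + 1 / 2) =
      ((∫ x in Set.Ioo (0 : ℝ) 1, x ^ (w - 1 / 2) * (1 - x) ^ (w - 1 / 2) : ℝ) : ℂ) := by
    rw [Complex.betaIntegral, intervalIntegral.integral_of_le zero_le_one,
      MeasureTheory.integral_Ioc_eq_integral_Ioo, ← integral_complex_ofReal]
    refine MeasureTheory.setIntegral_congr_fun measurableSet_Ioo fun x hx => ?_
    have h1 : (0 : ℝ) ≤ 1 - x := by linarith [hx.2]
    push_cast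
    rw [Complex.ofReal_cpow hx.1.le, Complex.ofReal_cpow h1]
    push_cast
    congr 2 <;> ring
  rw [hbeta, hsubst, ← Complex.ofReal_mul, intervalIntegral.integral_of_le Real.pi_pos.le,
    MeasureTheory.integral_Ioc_eq_integral_Ioo, ← MeasureTheory.integral_const_mul]
  congr 1
  refine MeasureTheory.setIntegral_congr_fun measurableSet_Ioo fun t ht => ?_
  have hs : 0 < Real.sin t := Real.sin_pos_of_pos_of_lt_pi ht.1 ht.2
  have hx : (1 - Real.cos t) / 2 ∈ Set.Ioo (0 : ℝ) 1 := by
    rw [← image_half_one_sub_cos]; exact ⟨t, ht, rfl⟩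
  have h4 : (1 - Real.cos t) / 2 * (1 - (1 - Real.cos t) / 2) = Real.sin t ^ 2 * 4⁻¹ := by
    rw [Real.sin_sq]; ring
  simp only [smul_eq_mul]
  rw [← Real.mul_rpow hx.1.le (by linarith [hx.2]), h4,
    Real.mul_rpow (by positivity) (by norm_num), abs_of_pos (by positivity), ← Real.rpow_natCast,
    ← Real.rpow_mul hs.le, Real.inv_rpow (by norm_num), Real.rpow_sub (by norm_num : (0 : ℝ) < 4),
    show ((2 : ℕ) : ℝ) * (w - 1 / 2) = 2 * w - 1 by push_cast; ring, Real.rpow_sub_one hs.ne',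
    show (4 : ℝ) ^ (1 / 2 : ℝ) = 2 by
      rw [← Real.sqrt_eq_rpow, show (4 : ℝ) = 2 ^ 2 by norm_num, Real.sqrt_sq (by norm_num)]]
  have : (0 : ℝ) < 4 ^ w := by positivity
  field_simp

lemma integral_sin_rpow_zero_pi {w : ℝ} (hw : 0 ≤ w) :
    ∫ t in (0 : ℝ)..Real.pi, Real.sin t ^ (2 * w) =
      2 * ∫ t in (0 : ℝ)..(Real.pi / 2), Real.sin t ^ (2 * w) := by
  have hcont : Continuous fun t : ℝ => Real.sin t ^ (2 * w) :=
    Real.continuous_sin.rpow_const fun _ => Or.inr (by positivity)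
  rw [← intervalIntegral.integral_add_adjacent_intervals (hcont.intervalIntegrable 0 (Real.pi / 2))
    (hcont.intervalIntegrable (Real.pi / 2) Real.pi)]
  have := intervalIntegral.integral_comp_sub_left (a := 0) (b := Real.pi / 2)
    (fun t : ℝ => Real.sin t ^ (2 * w)) Real.pi
  simp only [Real.sin_pi_sub, sub_zero] at this
  rw [this, sub_half]
  ring

lemma integral_sin_rpow_pos {w : ℝ} (hw : 0 ≤ w) :
    0 < ∫ t in (0 : ℝ)..(Real.pi / 2), Real.sin t ^ (2 * w) := by
  have hcont : Continuous fun t : ℝ => Real.sin t ^ (2 * w) :=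
    Real.continuous_sin.rpow_const fun _ => Or.inr (by positivity)
  refine intervalIntegral.intervalIntegral_pos_of_pos_on (hcont.intervalIntegrable _ _)
    (fun t ht => ?_) (by positivity)
  exact Real.rpow_pos_of_pos (Real.sin_pos_of_pos_of_lt_pi ht.1 (by linarith [ht.2, Real.pi_pos])) _

/-! ### The error rate at high average SNR -/

lemma tendsto_sin_sq_div_const_mul {A θ : ℝ} (hA : 0 < A) (hθ : 0 < θ) {t : ℝ} (ht : 0 < Real.sin t) :
    Tendsto (fun μ : ℝ => Real.sin t ^ 2 / (θ * (μ * A))) atTop (𝓝[>] 0) := by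
  refine tendsto_nhdsWithin_iff.2 ⟨?_, ?_⟩
  · exact tendsto_const_nhds.div_atTop ((tendsto_id.atTop_mul_const hA).const_mul_atTop hθ)
  · filter_upwards [eventually_gt_atTop 0] with μ hμ
    exact Set.mem_Ioi.2 (by positivity)

/-- Supplies the domination: since `sin² t ≤ 1`, the arguments tend to 0 uniformly in `t`. -/
lemma eventually_norm_comp_sin_sq_div_le {A θ : ℝ} (hA : 0 < A) (hθ : 0 < θ) {E : ℝ → ℂ} {R : ℂ}
    (hE : Tendsto E (𝓝[>] 0) (𝓝 R)) :
    ∀ᶠ μ : ℝ in atTop, ∀ t : ℝ, 0 < Real.sin t →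
      ‖E (Real.sin t ^ 2 / (θ * (μ * A)))‖ ≤ ‖R‖ + 1 := by
  have h1 : ∀ᶠ z in 𝓝[>] (0 : ℝ), ‖E z‖ ≤ ‖R‖ + 1 :=
    hE.norm.eventually (ge_mem_nhds (by linarith))
  obtain ⟨η, hη, h2⟩ := mem_nhdsGT_iff_exists_Ioo_subset.1 h1
  have h3 : Tendsto (fun μ : ℝ => 1 / (θ * (μ * A))) atTop (𝓝 0) :=
    tendsto_const_nhds.div_atTop ((tendsto_id.atTop_mul_const hA).const_mul_atTop hθ)
  filter_upwards [h3.eventually (gt_mem_nhds (Set.mem_Ioi.1 hη)), eventually_gt_atTop 0]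
    with μ hμ1 hμ0 t ht
  refine h2 ⟨by positivity, lt_of_le_of_lt ?_ hμ1⟩
  gcongr
  exact Real.sin_sq_le_one t

lemma tendsto_integral_sin_rpow_mul_prod {N : ℕ} {θ w : ℝ} (hθ : 0 < θ) (hw : 0 ≤ w)
    {A : Fin N → ℝ} (hA : ∀ j, 0 < A j) {E : Fin N → ℝ → ℂ} {R : Fin N → ℂ}
    (hEm : ∀ j, Measurable (E j)) (hE : ∀ j, Tendsto (E j) (𝓝[>] 0) (𝓝 (R j))) :
    Tendsto (fun μ : Fin N → ℝ => ∫ t in (0 : ℝ)..(Real.pi / 2),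
        ((Real.sin t ^ (2 * w) : ℝ) : ℂ) * ∏ j, E j (Real.sin t ^ 2 / (θ * (μ j * A j))))
      (Filter.pi fun _ => atTop)
      (𝓝 (((∫ t in (0 : ℝ)..(Real.pi / 2), Real.sin t ^ (2 * w) : ℝ) : ℂ) * ∏ j, R j)) := by
  have hpi := Real.pi_pos
  have hsin : ∀ t ∈ Set.uIoc 0 (Real.pi / 2), 0 < Real.sin t := fun t ht => by
    rw [Set.uIoc_of_le (by positivity)] at ht
    exact Real.sin_pos_of_pos_of_lt_pi ht.1 (by linarith [ht.2])
  have hcoord : ∀ j : Fin N, Tendsto (fun μ : Fin N → ℝ => μ j) (Filter.pi fun _ => atTop) atTop :=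
    fun j => tendsto_eval_pi _ j
  rw [← intervalIntegral.integral_ofReal, ← intervalIntegral.integral_mul_const]
  refine intervalIntegral.tendsto_integral_filter_of_dominated_convergence
    (fun _ => ∏ j, (‖R j‖ + 1)) ?_ ?_ (by simp) ?_
  · refine Eventually.of_forall fun μ => Measurable.aestronglyMeasurable ?_
    refine Measurable.mul (by fun_prop) (Finset.measurable_prod _ fun j _ => (hEm j).comp ?_)
    fun_prop
  · have hall := eventually_all.2 fun j : Fin N =>
      (hcoord j).eventually (eventually_norm_comp_sin_sq_div_le (hA j) hθ (hE j))
    filter_upwards [hall] with μ hμ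
    refine Eventually.of_forall fun t ht => ?_
    have hs := hsin t ht
    rw [norm_mul, norm_prod, Complex.norm_real, Real.norm_eq_abs,
      abs_of_nonneg (Real.rpow_nonneg hs.le _), ← one_mul (∏ j, (‖R j‖ + 1))]
    gcongr with j
    · exact Real.rpow_le_one hs.le (Real.sin_le_one t) (by positivity)
    · exact hμ j t hs
  · refine Eventually.of_forall fun t ht => ?_
    refine Tendsto.const_mul _ (tendsto_finsetProd _ fun j _ => ?_)
    exact (hE j).comp ((tendsto_sin_sq_div_const_mul (hA j) hθ (hsin t ht)).comp (hcoord j))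

/-- At `x = θ / sin² t` each power splits into its value at `x = θ` times `sin^{2(u_j + 1)} t`, so
all SNR-dependent powers leave the integral. -/
lemma aserOfMgf_prod_eq {N : ℕ} {ρ θ : ℝ} (hθ : 0 < θ) {u A μ : Fin N → ℝ} (hA : ∀ j, 0 < A j)
    (hμ : ∀ j, 0 < μ j) (τ : Fin N → ℂ) (E : Fin N → ℝ → ℂ) {M : ℝ → ℂ}
    (hM : ∀ x : ℝ, 0 < x → M x = ∏ j, τ j * (((1 / (x * (μ j * A j))) ^ (u j + 1) : ℝ) : ℂ) *
      E j (1 / (x * (μ j * A j)))) :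
    aserOfMgf ρ θ M = (2 * ρ / Real.pi : ℂ) *
      (∏ j, τ j * (((1 / (θ * (μ j * A j))) ^ (u j + 1) : ℝ) : ℂ)) *
      ∫ t in (0 : ℝ)..(Real.pi / 2), ((Real.sin t ^ (2 * ∑ j, (u j + 1)) : ℝ) : ℂ) *
        ∏ j, E j (Real.sin t ^ 2 / (θ * (μ j * A j))) := by
  unfold aserOfMgf
  rw [mul_assoc]
  congr 1
  have h0 : (0 : ℝ) ≤ Real.pi / 2 := by positivity
  rw [← intervalIntegral.integral_const_mul, intervalIntegral.integral_of_le h0, intervalIntegral.integral_of_le h0]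
  refine MeasureTheory.setIntegral_congr_fun measurableSet_Ioc fun t ht => ?_
  have hs : 0 < Real.sin t := Real.sin_pos_of_pos_of_lt_pi ht.1 (by linarith [ht.2, Real.pi_pos])
  have hz : ∀ j, 1 / (θ / Real.sin t ^ 2 * (μ j * A j)) = Real.sin t ^ 2 / (θ * (μ j * A j)) := by
    intro j
    have := (hA j).ne'
    have := (hμ j).ne'
    field_simp
  have hpow : ∀ j, (Real.sin t ^ 2 / (θ * (μ j * A j))) ^ (u j + 1) =
      (1 / (θ * (μ j * A j))) ^ (u j + 1) * Real.sin t ^ (2 * (u j + 1)) := by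
    intro j
    have := hA j
    have := hμ j
    rw [div_eq_mul_one_div, mul_comm, Real.mul_rpow (by positivity) (by positivity),
      ← Real.rpow_natCast, ← Real.rpow_mul hs.le]
    norm_num
  rw [hM _ (by positivity)]
  simp only [hz, hpow]
  rw [Finset.mul_sum, Real.rpow_sum_of_pos hs, Complex.ofReal_prod, ← mul_assoc,
    ← Finset.prod_mul_distrib, ← Finset.prod_mul_distrib]
  refine Finset.prod_congr rfl fun j _ => ?_
  push_cast
  ring

lemma exists_meijerG_expansion (a₃ a₄ : ℂ) {u v : ℝ} (hu : -1 < u) (huv : u < v) :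
    ∃ E : ℝ → ℂ, Measurable E ∧ Tendsto E (𝓝[>] 0) (𝓝 (meijerCofactor a₃ a₄ v (-u))) ∧
      ∀ z : ℝ, 0 < z →
        meijerG [0] [a₃, a₄] [(u : ℂ), (v : ℂ)] [] z = ((z ^ u : ℝ) : ℂ) * E z ∧
        meijerG [0] [a₃, a₄] [(v : ℂ), (u : ℂ)] [] z = ((z ^ u : ℝ) : ℂ) * E z := by
  obtain ⟨c, h1, h2, h3, h⟩ := exists_meijerG_eq_meijerLine a₃ a₄ hu (hu.trans huv)
  refine ⟨fun z => meijerLine a₃ a₄ u v c z / ((z ^ u : ℝ) : ℂ), ?_,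
    tendsto_meijerLine_div a₃ a₄ huv h1 h3, fun z hz => ?_⟩
  · exact (stronglyMeasurable_meijerLine a₃ a₄ h1 h2 h3).measurable.div (by fun_prop)
  · have hz0 : ((z ^ u : ℝ) : ℂ) ≠ 0 := by exact_mod_cast (Real.rpow_pos_of_pos hz u).ne'
    rw [(h z).1, (h z).2, mul_div_cancel₀ _ hz0]
    exact ⟨rfl, rfl⟩

/-! ### The branch MGF in terms of one fixed function -/

namespace Malaga

variable (P : Malaga)

/-- Small-argument form of the moment generating function of a branch, uniformly in the SNR. -/
structure Expansion (u A : ℝ) (τ R : ℂ) (E : ℝ → ℂ) : Prop where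
  u_gt : -1 < u
  A_pos : 0 < A
  τ_ne : τ ≠ 0
  R_ne : R ≠ 0
  measurable : Measurable E
  tendsto : Tendsto E (𝓝[>] 0) (𝓝 R)
  min_eq : ∀ μ : ℝ, 0 < μ → min (P.a₅ μ).re (P.a₆ μ).re = u
  aExp_eq : ∀ μ : ℝ, 0 < μ → P.aExp μ (P.minIdx μ) = u
  a₂_eq : ∀ μ : ℝ, 0 < μ → P.a₂ μ = ((μ * A : ℝ) : ℂ)
  tau_eq : ∀ μ : ℝ, 0 < μ → P.tau μ = τ
  b_eq : ∀ μ : ℝ, 0 < μ → P.b μ (P.minIdx μ) 0 = R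
  mgf_eq : ∀ μ : ℝ, 0 < μ → ∀ x : ℝ, 0 < x →
    P.mgf μ x = τ * (((1 / (x * (μ * A))) ^ (u + 1) : ℝ) : ℂ) * E (1 / (x * (μ * A)))

lemma exists_expansion (h : P.Admissible 1) :
    ∃ (u A : ℝ) (τ R : ℂ) (E : ℝ → ℂ), P.Expansion u A τ R E := by
  have h5 : P.a₅ 1 = ((P.a₅ 1).re : ℂ) := Complex.ext (by simp) (by simpa using h.a₅_im)
  have h6 : P.a₆ 1 = ((P.a₆ 1).re : ℂ) := Complex.ext (by simp) (by simpa using h.a₆_im)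
  have h2 : P.a₂ 1 = ((P.a₂ 1).re : ℂ) := Complex.ext (by simp) (by simpa using h.a₂_im)
  have hg5 := h.a₅_gt
  have hg6 := h.a₆_gt
  have hA := h.a₂_pos
  have hne56 : (P.a₅ 1).re ≠ (P.a₆ 1).re := fun hh => h.a₅_ne_a₆ (by rw [h5, h6, hh])
  have hτ : P.tau 1 ≠ 0 := by
    unfold tau
    refine div_ne_zero (mul_ne_zero (Complex.Gamma_ne_zero h.a₃_ne) (Complex.Gamma_ne_zero h.a₄_ne))
      (mul_ne_zero (Complex.Gamma_ne_zero_of_re_pos ?_) (Complex.Gamma_ne_zero_of_re_pos ?_))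
    · rw [Complex.add_re, Complex.one_re]; linarith
    · rw [Complex.add_re, Complex.one_re]; linarith
  have ha₂ : ∀ μ : ℝ, 0 < μ → P.a₂ μ = ((μ * (P.a₂ 1).re : ℝ) : ℂ) := fun μ hμ => by
    rw [P.a₂_scale hμ, Complex.ofReal_mul, ← h2]
  have hmgf : ∀ (u : ℝ) (E : ℝ → ℂ),
      (∀ z : ℝ, 0 < z →
        meijerG [0] [P.a₃ 1, P.a₄ 1] [P.a₅ 1, P.a₆ 1] [] z = ((z ^ u : ℝ) : ℂ) * E z) →
      ∀ μ : ℝ, 0 < μ → ∀ x : ℝ, 0 < x →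
        P.mgf μ x = P.tau 1 * (((1 / (x * (μ * (P.a₂ 1).re))) ^ (u + 1) : ℝ) : ℂ) *
          E (1 / (x * (μ * (P.a₂ 1).re))) := by
    intro u E hE μ hμ x hx
    have hz : 0 < 1 / (x * (μ * (P.a₂ 1).re)) := by positivity
    -- `a₁ = τ / a₂`, so the prefactor is `τ z`; this raises the exponent from `u` to `u + 1`.
    have hpre : P.a₁ μ / x = P.tau 1 * ((1 / (x * (μ * (P.a₂ 1).re)) : ℝ) : ℂ) := by
      rw [← P.tau_scale hμ]
      unfold a₁ tau
      rw [ha₂ μ hμ]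
      push_cast
      simp only [div_eq_mul_inv, mul_inv]
      ring
    unfold mgf
    rw [P.a₃_scale hμ, P.a₄_scale hμ, P.a₅_scale hμ, P.a₆_scale hμ, hpre, ha₂ μ hμ,
      Complex.ofReal_re, hE _ hz, Real.rpow_add_one hz.ne', Complex.ofReal_mul]
    ring
  have h3ne := h.a₃_sub_ne
  have h4ne := h.a₄_sub_ne
  rcases lt_or_gt_of_ne hne56 with hlt | hlt
  · have hidx : P.minIdx 1 = 1 := by simp [minIdx, hlt]
    have hexp : P.aExp 1 1 = P.a₅ 1 := by simp [aExp]
    rw [hidx, hexp] at h3ne h4ne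
    obtain ⟨E, hEm, hEt, hE⟩ := exists_meijerG_expansion (P.a₃ 1) (P.a₄ 1) hg5 hlt
    -- The leading coefficient is the residue coefficient at `s = -a₅`; its nonvanishing uses the
    -- conditions on `a₃ - a₅` and `a₄ - a₅`.
    have hb : P.b 1 1 0 = meijerCofactor (P.a₃ 1) (P.a₄ 1) (P.a₆ 1).re (-((P.a₅ 1).re : ℂ)) := by
      unfold b meijerCofactor
      rw [hexp, ← h5, ← h6]
      norm_num
      rw [← sub_eq_add_neg, ← sub_eq_add_neg, ← sub_eq_add_neg]
      field_simp
    refine ⟨(P.a₅ 1).re, (P.a₂ 1).re, P.tau 1, P.b 1 1 0, E, hg5, hA, hτ, ?_, hEm, hb ▸ hEt,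
      fun μ hμ => ?_, fun μ hμ => ?_, ha₂, fun μ hμ => P.tau_scale hμ, fun μ hμ => ?_,
      hmgf _ E fun z hz => ?_⟩
    · rw [hb]
      unfold meijerCofactor
      refine mul_ne_zero (mul_ne_zero (Complex.Gamma_ne_zero_of_re_pos ?_)
        (Complex.Gamma_ne_zero_of_re_pos ?_)) (mul_ne_zero (inv_ne_zero (Complex.Gamma_ne_zero ?_))
        (inv_ne_zero (Complex.Gamma_ne_zero ?_)))
      · simp; linarith
      · simp; linarith
      · rwa [← sub_eq_add_neg, ← h5]
      · rwa [← sub_eq_add_neg, ← h5]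
    · rw [P.a₅_scale hμ, P.a₆_scale hμ, min_eq_left hlt.le]
    · rw [P.minIdx_scale hμ, P.aExp_scale hμ, hidx, hexp, ← h5]
    · rw [P.minIdx_scale hμ, P.b_zero_scale hμ, hidx]
    · rw [h5, h6]; simpa using (hE z hz).1
  · have hidx : P.minIdx 1 = 2 := by simp [minIdx, hlt.le]
    have hexp : P.aExp 1 2 = P.a₆ 1 := by simp [aExp]
    rw [hidx, hexp] at h3ne h4ne
    obtain ⟨E, hEm, hEt, hE⟩ := exists_meijerG_expansion (P.a₃ 1) (P.a₄ 1) hg6 hlt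
    -- For `k = 2` the sign `3 - 2k = -1` turns `a₆ - a₅` into `a₅ - a₆`, the argument met at the
    -- pole `s = -a₆`.
    have hb : P.b 1 2 0 = meijerCofactor (P.a₃ 1) (P.a₄ 1) (P.a₅ 1).re (-((P.a₆ 1).re : ℂ)) := by
      unfold b meijerCofactor
      rw [hexp, ← h5, ← h6]
      norm_num
      rw [← sub_eq_add_neg, ← sub_eq_add_neg, ← sub_eq_add_neg]
      field_simp
    refine ⟨(P.a₆ 1).re, (P.a₂ 1).re, P.tau 1, P.b 1 2 0, E, hg6, hA, hτ, ?_, hEm, hb ▸ hEt,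
      fun μ hμ => ?_, fun μ hμ => ?_, ha₂, fun μ hμ => P.tau_scale hμ, fun μ hμ => ?_,
      hmgf _ E fun z hz => ?_⟩
    · rw [hb]
      unfold meijerCofactor
      refine mul_ne_zero (mul_ne_zero (Complex.Gamma_ne_zero_of_re_pos ?_)
        (Complex.Gamma_ne_zero_of_re_pos ?_)) (mul_ne_zero (inv_ne_zero (Complex.Gamma_ne_zero ?_))
        (inv_ne_zero (Complex.Gamma_ne_zero ?_)))
      · simp; linarith
      · simp; linarith
      · rwa [← sub_eq_add_neg, ← h6]
      · rwa [← sub_eq_add_neg, ← h6]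
    · rw [P.a₅_scale hμ, P.a₆_scale hμ, min_eq_right hlt.le]
    · rw [P.minIdx_scale hμ, P.aExp_scale hμ, hidx, hexp, ← h6]
    · rw [P.minIdx_scale hμ, P.b_zero_scale hμ, hidx]
    · rw [h5, h6]; simpa using (hE z hz).2

end Malaga

/-! ### Matching the limit with the stated constants -/

lemma aserINIDAsymptotic_eq {N : ℕ} {ρ θ : ℝ} (hθ : 0 < θ) {P : Fin N → Malaga} {u A : Fin N → ℝ}
    {τ R : Fin N → ℂ} {E : Fin N → ℝ → ℂ} (h : ∀ j, (P j).Expansion (u j) (A j) (τ j) (R j) (E j))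
    {μ : Fin N → ℝ} (hμ : ∀ j, 0 < μ j) :
    aserINIDAsymptotic ρ θ P μ = (2 * ρ / Real.pi : ℂ) *
      (∏ j, τ j * (((1 / (θ * (μ j * A j))) ^ (u j + 1) : ℝ) : ℂ)) *
      (((∫ t in (0 : ℝ)..(Real.pi / 2), Real.sin t ^ (2 * ∑ j, (u j + 1)) : ℝ) : ℂ) *
        ∏ j, R j) := by
  set w := ∑ j, (u j + 1) with hw
  have hw0 : 0 ≤ w := Finset.sum_nonneg fun j _ => by linarith [(h j).u_gt]
  have hζ : zetaSum P μ + N = (w : ℂ) := by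
    unfold zetaSum
    rw [hw, Finset.sum_add_distrib, Finset.sum_congr rfl fun j _ => (h j).aExp_eq (μ j) (hμ j)]
    simp
  have hprod : (∏ j, τ j * (((1 / (θ * (μ j * A j))) ^ (u j + 1) : ℝ) : ℂ)) =
      ((θ⁻¹ ^ w : ℝ) : ℂ) * ∏ j, τ j * (((μ j * A j) ^ (-u j - 1) : ℝ) : ℂ) := by
    rw [hw, Real.rpow_sum_of_pos (inv_pos.2 hθ), Complex.ofReal_prod, ← Finset.prod_mul_distrib]
    refine Finset.prod_congr rfl fun j _ => ?_
    have hp : 0 < μ j * A j := mul_pos (hμ j) (h j).A_pos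
    rw [one_div, mul_inv, Real.mul_rpow (inv_pos.2 hθ).le (inv_pos.2 hp).le, Real.inv_rpow hp.le,
      ← Real.rpow_neg hp.le, neg_add', Complex.ofReal_mul]
    ring
  have hbranch : ∏ j, ((P j).b (μ j) ((P j).minIdx (μ j)) 0 * (P j).tau (μ j) *
      (P j).a₂ (μ j) ^ (-(P j).aExp (μ j) ((P j).minIdx (μ j)) - 1)) =
      (∏ j, R j) * ∏ j, τ j * (((μ j * A j) ^ (-u j - 1) : ℝ) : ℂ) := by
    rw [← Finset.prod_mul_distrib]
    refine Finset.prod_congr rfl fun j _ => ?_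
    have hp : 0 < μ j * A j := mul_pos (hμ j) (h j).A_pos
    rw [(h j).b_eq _ (hμ j), (h j).tau_eq _ (hμ j), (h j).a₂_eq _ (hμ j), (h j).aExp_eq _ (hμ j),
      Complex.ofReal_cpow hp.le, mul_assoc]
    push_cast
    rfl
  have hfour : (4 / θ : ℂ) ^ (w : ℂ) = (((4 : ℝ) ^ w : ℝ) : ℂ) * ((θ⁻¹ ^ w : ℝ) : ℂ) := by
    rw [← Complex.ofReal_mul, ← Real.mul_rpow (by norm_num) (inv_pos.2 hθ).le,
      Complex.ofReal_cpow (by positivity)]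
    push_cast
    rw [div_eq_mul_inv]
  have hbeta := four_rpow_mul_betaIntegral_eq w
  rw [integral_sin_rpow_zero_pi hw0, Complex.ofReal_mul, Complex.ofReal_ofNat] at hbeta
  unfold aserINIDAsymptotic
  rw [hζ, hbranch, hprod, hfour]
  -- `4^w B(w + 1/2, w + 1/2)` is twice the integral over `[0, π/2]`, which reconciles `ρ/π` with
  -- `2ρ/π`.
  linear_combination (ρ / Real.pi : ℂ) * ((θ⁻¹ ^ w : ℝ) : ℂ) * (∏ j, R j) *
    (∏ j, τ j * (((μ j * A j) ^ (-u j - 1) : ℝ) : ℂ)) * hbeta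

lemma aserINID_isEquivalent {N : ℕ} {ρ θ : ℝ} (hθ : 0 < θ) {P : Fin N → Malaga} {u A : Fin N → ℝ}
    {τ R : Fin N → ℂ} {E : Fin N → ℝ → ℂ} (h : ∀ j, (P j).Expansion (u j) (A j) (τ j) (R j) (E j)) :
    (fun μ : Fin N → ℝ => aserINID ρ θ P μ) ~[Filter.pi fun _ => atTop]
      (fun μ : Fin N → ℝ => aserINIDAsymptotic ρ θ P μ) := by
  have hw0 : 0 ≤ ∑ j, (u j + 1) := Finset.sum_nonneg fun j _ => by linarith [(h j).u_gt]
  have hlim := tendsto_integral_sin_rpow_mul_prod hθ hw0 (fun j => (h j).A_pos)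
    (fun j => (h j).measurable) (fun j => (h j).tendsto)
  have hne : ((∫ t in (0 : ℝ)..(Real.pi / 2), Real.sin t ^ (2 * ∑ j, (u j + 1)) : ℝ) : ℂ) *
      ∏ j, R j ≠ 0 :=
    mul_ne_zero (by exact_mod_cast (integral_sin_rpow_pos hw0).ne')
      (Finset.prod_ne_zero_iff.2 fun j _ => (h j).R_ne)
  -- The limit of the integral is nonzero, so convergence to it is an equivalence and may be
  -- multiplied by the exact prefactor.
  have hequiv := (IsEquivalent.refl (u := fun μ : Fin N → ℝ => (2 * ρ / Real.pi : ℂ) *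
      (∏ j, τ j * (((1 / (θ * (μ j * A j))) ^ (u j + 1) : ℝ) : ℂ)))).mul
    ((isEquivalent_const_iff_tendsto hne).2 hlim)
  have hpos : ∀ᶠ μ : Fin N → ℝ in Filter.pi fun _ => atTop, ∀ j, 0 < μ j :=
    eventually_all.2 fun j => (tendsto_eval_pi (fun _ => atTop) j).eventually
      (eventually_gt_atTop (0 : ℝ))
  refine (hequiv.congr_left ?_).congr_right ?_
  · filter_upwards [hpos] with μ hμ
    refine (aserOfMgf_prod_eq hθ (fun j => (h j).A_pos) hμ τ E fun x hx => ?_).symm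
    exact Finset.prod_congr rfl fun j _ => (h j).mgf_eq _ (hμ j) x hx
  · filter_upwards [hpos] with μ hμ
    exact (aserINIDAsymptotic_eq hθ h hμ).symm

lemma aserINIDAsymptotic_const_eq {N : ℕ} (ρ θ : ℝ) {P : Malaga} {u A : ℝ} {τ R : ℂ} {E : ℝ → ℂ}
    (h : P.Expansion u A τ R E) {μ : ℝ} (hμ : 0 < μ) :
    aserINIDAsymptotic ρ θ (fun _ : Fin N => P) (fun _ => μ) =
      P.codingGain ρ θ N μ * P.a₂ μ ^ (-((N * (u + 1) : ℝ) : ℂ)) := by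
  have hζ : zetaSum (fun _ : Fin N => P) (fun _ => μ) + N = N * ((u : ℂ) + 1) := by
    unfold zetaSum
    simp only [h.aExp_eq μ hμ, Finset.sum_const, Finset.card_univ, Fintype.card_fin, nsmul_eq_mul]
    ring
  have ha : P.a₂ μ ^ (-((N * (u + 1) : ℝ) : ℂ)) = (P.a₂ μ ^ (-(u : ℂ) - 1)) ^ N := by
    rw [← Complex.cpow_nat_mul]
    congr 1
    push_cast
    ring
  unfold aserINIDAsymptotic Malaga.codingGain
  rw [hζ, h.aExp_eq μ hμ, ha, Complex.cpow_nat_mul, Finset.prod_const, Finset.card_univ,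
    Fintype.card_fin]
  simp only [mul_pow, h.aExp_eq μ hμ]
  ring

/-- Needed to take logarithms for the diversity order. The Beta factor is nonzero because it is a
multiple of the integral of a positive power of the sine. -/
lemma Malaga.codingGain_ne_zero {N : ℕ} {ρ θ : ℝ} (hρ : 0 < ρ) (hθ : 0 < θ) {P : Malaga} {u A : ℝ}
    {τ R : ℂ} {E : ℝ → ℂ} (h : P.Expansion u A τ R E) : P.codingGain ρ θ N 1 ≠ 0 := by
  have hu := h.u_gt
  have hw0 : 0 ≤ (N : ℝ) * (u + 1) := mul_nonneg N.cast_nonneg (by linarith)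
  have hbeta : Complex.betaIntegral (N * ((u : ℂ) + 1) + 1 / 2) (N * ((u : ℂ) + 1) + 1 / 2) ≠ 0 := by
    have hb := four_rpow_mul_betaIntegral_eq (N * (u + 1))
    rw [integral_sin_rpow_zero_pi hw0] at hb
    push_cast at hb
    intro h0
    rw [h0, mul_zero, eq_comm, mul_eq_zero] at hb
    have := (integral_sin_rpow_pos hw0).ne'
    rcases hb with hb | hb
    · norm_num at hb
    · exact this (by exact_mod_cast hb)
  unfold codingGain
  rw [h.aExp_eq 1 one_pos, h.tau_eq 1 one_pos, h.b_eq 1 one_pos]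
  have hθ' : (4 / θ : ℂ) ≠ 0 := by
    exact_mod_cast (div_pos four_pos hθ).ne'
  have hρ' : (ρ / Real.pi : ℂ) ≠ 0 := by exact_mod_cast (div_pos hρ Real.pi_pos).ne'
  refine mul_ne_zero (mul_ne_zero hρ' (pow_ne_zero _ (mul_ne_zero (mul_ne_zero ?_ h.τ_ne) h.R_ne)))
    hbeta
  rw [Ne, Complex.cpow_eq_zero_iff]
  exact fun hh => hθ' hh.1

/-- A function equivalent to `c (A x)^{-d}` has logarithmic decay rate `d`. -/
lemma tendsto_neg_log_norm_div_log {f : ℝ → ℂ} {c : ℂ} (hc : c ≠ 0) {A d : ℝ} (hA : 0 < A)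
    (hf : f ~[atTop] fun x : ℝ => c * ((x * A : ℝ) : ℂ) ^ (-(d : ℂ))) :
    Tendsto (fun x : ℝ => -Real.log ‖f x‖ / Real.log x) atTop (𝓝 d) := by
  have hpos : ∀ᶠ x : ℝ in atTop, 0 < x * A := by
    filter_upwards [eventually_gt_atTop 0] with x hx using mul_pos hx hA
  have hne : ∀ᶠ x : ℝ in atTop, c * ((x * A : ℝ) : ℂ) ^ (-(d : ℂ)) ≠ 0 := by
    filter_upwards [hpos] with x hx
    refine mul_ne_zero hc ?_
    rw [Ne, Complex.cpow_eq_zero_iff]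
    exact fun hh => hx.ne' (by exact_mod_cast hh.1)
  have hratio := ((isEquivalent_iff_tendsto_one hne).1 hf).norm
  rw [norm_one] at hratio
  have hlog := (Real.continuousAt_log one_ne_zero).tendsto.comp hratio
  rw [Real.log_one] at hlog
  -- `-log|f| = d log x` minus a convergent quantity, which vanishes after division by `log x`.
  have hmain := ((hlog.add_const (Real.log ‖c‖ - d * Real.log A)).div_atTop
    Real.tendsto_log_atTop).const_sub d
  rw [sub_zero] at hmain
  refine hmain.congr' ?_
  filter_upwards [hne, eventually_gt_atTop 1,
    hratio.eventually (lt_mem_nhds (show (0 : ℝ) < 1 by norm_num))] with x hx hx1 hr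
  have hx0 : 0 < x := by linarith
  have hlx : Real.log x ≠ 0 := (Real.log_pos hx1).ne'
  have hg : Real.log ‖c * ((x * A : ℝ) : ℂ) ^ (-(d : ℂ))‖ =
      Real.log ‖c‖ - d * (Real.log x + Real.log A) := by
    have hxA : 0 < x * A := mul_pos hx0 hA
    rw [norm_mul, Complex.norm_cpow_eq_rpow_re_of_pos hxA, Real.log_mul (norm_ne_zero_iff.2 hc)
      (Real.rpow_pos_of_pos hxA _).ne', Real.log_rpow hxA, Real.log_mul hx0.ne' hA.ne']
    simp
    ring
  simp only [Function.comp, Pi.div_apply] at hr ⊢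
  rw [norm_div] at hr ⊢
  have hfx : ‖f x‖ ≠ 0 := fun h0 => by rw [h0, zero_div] at hr; exact lt_irrefl _ hr
  rw [Real.log_div hfx (norm_ne_zero_iff.2 hx), hg]
  field_simp
  ring

end

theorem corollary2 (N : ℕ) (hN : 1 ≤ N) (ρ θ : ℝ) (hρ : 0 < ρ) (hθ : 0 < θ) :
    (∀ P : Malaga, (∀ μ₁ : ℝ, 0 < μ₁ → P.Admissible μ₁) →
      ∃ (Gc : ℂ) (Gd : ℝ),
        (∀ μ₁ : ℝ, 0 < μ₁ →
          Gc = P.codingGain ρ θ N μ₁ ∧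
          (Gd : ℂ) = N * (P.aExp μ₁ (P.minIdx μ₁) + 1) ∧
          Gd = N * (min (P.a₅ μ₁).re (P.a₆ μ₁).re + 1)) ∧
        (fun μ₁ : ℝ => aserIID ρ θ N P μ₁) ~[atTop]
          (fun μ₁ : ℝ => Gc * P.a₂ μ₁ ^ (-(Gd : ℂ))) ∧
        Tendsto (fun μ₁ : ℝ => -Real.log ‖aserIID ρ θ N P μ₁‖ / Real.log μ₁) atTop (𝓝 Gd)) ∧
    (∀ P : Fin N → Malaga, (∀ j, ∀ μ₁ : ℝ, 0 < μ₁ → (P j).Admissible μ₁) →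
      (∀ j, ∀ μ₁ : ℝ, 0 < μ₁ →
        ((P j).aExp μ₁ ((P j).minIdx μ₁)).re = min ((P j).a₅ μ₁).re ((P j).a₆ μ₁).re) ∧
      (fun μ₁ : Fin N → ℝ => aserINID ρ θ P μ₁) ~[Filter.pi fun _ => atTop]
        (fun μ₁ : Fin N → ℝ => aserINIDAsymptotic ρ θ P μ₁)) := by
  constructor
  · intro P hP
    obtain ⟨u, A, τ, R, E, h⟩ := P.exists_expansion (hP 1 one_pos)
    -- The i.i.d. case is the joint limit restricted to equal SNRs and equal parameters.
    have hdiag : Tendsto (fun (μ : ℝ) (_ : Fin N) => μ) atTop (Filter.pi fun _ => atTop) :=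
      tendsto_pi.2 fun _ => tendsto_id
    have hinid := (aserINID_isEquivalent (ρ := ρ) hθ fun _ : Fin N => h).comp_tendsto hdiag
    have hiid : (fun μ₁ : ℝ => aserIID ρ θ N P μ₁) ~[atTop]
        (fun μ₁ : ℝ => P.codingGain ρ θ N 1 * P.a₂ μ₁ ^ (-((N * (u + 1) : ℝ) : ℂ))) := by
      refine (hinid.congr_left ?_).congr_right ?_
      · refine Eventually.of_forall fun μ => ?_
        simp [aserINID, aserIID]
      · filter_upwards [eventually_gt_atTop 0] with μ hμ
        simp only [Function.comp]
        rw [aserINIDAsymptotic_const_eq ρ θ h hμ, P.codingGain_scale hμ]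
    refine ⟨P.codingGain ρ θ N 1, N * (u + 1), fun μ hμ => ⟨(P.codingGain_scale hμ ρ θ N).symm, ?_, ?_⟩,
      hiid, ?_⟩
    · rw [h.aExp_eq μ hμ]; push_cast; rfl
    · rw [h.min_eq μ hμ]
    · refine tendsto_neg_log_norm_div_log (Malaga.codingGain_ne_zero (N := N) hρ hθ h) h.A_pos
        (hiid.congr_right ?_)
      filter_upwards [eventually_gt_atTop 0] with μ hμ
      rw [h.a₂_eq μ hμ]
  · intro P hP
    have hex := fun j => (P j).exists_expansion (hP j 1 one_pos)
    choose u A τ R E h using hex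
    refine ⟨fun j μ hμ => ?_, aserINID_isEquivalent hθ h⟩
    rw [(h j).aExp_eq μ hμ, (h j).min_eq μ hμ, Complex.ofReal_re]
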